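/- Let $n\ge 1$, $d\gamma(y)=e^{-|y|^2}\,dy$ on $\mathbb R^n$, $m(x)=\min(1,1/|x|)$ with $m(0)=1$, and $m_\beta=\beta m$. On $\mathbb R^{n+1}_+=\mathbb R^n\times(0,\infty)$ consider the measure $d\gamma(y)\,\frac{dt}{t}$. For $\alpha,\beta>0$ let $$\Gamma^{\alpha,\beta}_\gamma(x)=\{(y,t)\in\mathbb R^{n+1}_+:|y-x|<\min(\alpha t,m_\beta(y))\},\qquad T^{\alpha,\beta}_\gamma(O)=\mathbb R^{n+1}_+\setminus\bigcup_{x\notin O}\Gamma^{\alpha,\beta}_\gamma(x)$$ for $x\in\mathbb R^n$ and $O\subset\mathbb R^n$ (Gaussian cones and tents). For $f:\mathbb R^{n+1}_+\to\mathbb R$ put $$S_{q,\alpha,\beta}f(x)=\Big(\iint_{\Gamma^{\alpha,\beta}_\gamma(x)}\frac{|f(y,t)|^q}{\gamma(B(y,\min(\alpha t,m_\beta(y))))}\,d\gamma(y)\frac{dt}{t}\Big)^{1/q}\quad(1\le q<\infty),\qquad S_{\infty,\alpha,\beta}f(x)=\sup_{\Gamma^{\alpha,\beta}_\gamma(x)}|f|.$$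 The Gaussian tent space $T^{1,q}_{\alpha,\beta}(\gamma)$ consists of the measurable (for $q=\infty$: continuous) functions $f$ on $\mathbb R^{n+1}_+$ with $\|f\|_{T^{1,q}_{\alpha,\beta}(\gamma)}:=\|S_{q,\alpha,\beta}f\|_{L^1(\gamma)}<\infty$. For $\delta>0$, a $T^{1,q}_{\alpha,\beta}(\gamma)$ $\delta$-atom is a measurable (for $q=\infty$: continuous) function $a$ on $\mathbb R^{n+1}_+$ for which there is an open ball $B=B(c,r)$ with $0<r\le\delta m(c)$, $\operatorname{supp}a\subset T^{\alpha,\beta}_\gamma(B)$ and $\|a\|_{L^q(\mathbb R^{n+1}_+,\,d\gamma\,dt/t)}\le\gamma(B)^{-(1-1/q)}$ (with $1/\infty=0$). **Theorem (Atomic decomposition).** Let $\alpha,\beta>0$ and $1\le q\le\infty$. 1. There are $\delta>0$ and $C>0$ (independent of $f$) such that for every $f\in T^{1,q}_{\alpha,\beta}(\gamma)$ there exist $\{\lambda_m\}_{m\in\mathbb N}\in\ell^1$ and $T^{1,q}_{\alpha,\beta}(\gamma)$ $\delta$-atoms $\{a_m\}_{m\in\mathbb N}$ with $$f=\sum_m\lambda_m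 a_m,\qquad \sum_m|\lambda_m|\le C\,\|f\|_{T^{1,q}_{\alpha,\beta}(\gamma)}.$$ 2. For every $\delta>0$, every $T^{1,q}_{\alpha,\beta}(\gamma)$ $\delta$-atom $a$ belongs to $T^{1,q}_{\alpha,\beta}(\gamma)$ and $\|a\|_{T^{1,q}_{\alpha,\beta}(\gamma)}\le1$. 3. Conversely, for every $\delta>0$, every $\{\lambda_m\}\in\ell^1$ and every sequence $\{a_m\}$ of $T^{1,q}_{\alpha,\beta}(\gamma)$ $\delta$-atoms, there is $f\in T^{1,q}_{\alpha,\beta}(\gamma)$ with $f=\sum_m\lambda_m a_m$ and $\|f\|_{T^{1,q}_{\alpha,\beta}(\gamma)}\le\sum_m|\lambda_m|$. Here $f=\sum_m\lambda_m a_m$ means that the partial sums converge to $f$ in the norm of $T^{1,q}_{\alpha,\beta}(\gamma)$ and that the series converges absolutely to $f$ at almost every point of $\mathbb R^{n+1}_+$ (at every point if $q=\infty$). -/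

import Mathlib

open MeasureTheory Filter Topology
open scoped ENNReal

namespace GaussTent

noncomputable section

/-- Euclidean space `ℝⁿ` with the Euclidean norm. -/
abbrev E (n : ℕ) : Type := EuclideanSpace ℝ (Fin n)

/-- The open upper half-space `ℝⁿ × (0, ∞)`. -/
abbrev HalfSpace (n : ℕ) : Type := E n × Set.Ioi (0 : ℝ)

/-- The (non-normalized) Gaussian measure `dγ(y) = exp (-|y|²) dy`. -/
def gauss (n : ℕ) : Measure (E n) :=
  volume.withDensity fun y => ENNReal.ofReal (Real.exp (-‖y‖ ^ 2))

/-- The measure `dt / t` on `(0, ∞)`. -/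
def dtOverT : Measure (Set.Ioi (0 : ℝ)) :=
  (Measure.comap ((↑) : Set.Ioi (0 : ℝ) → ℝ) volume).withDensity
    fun t => ENNReal.ofReal (1 / (t : ℝ))

/-- The measure `dγ(y) dt / t` on the upper half-space. It has the same null sets as Lebesgue
measure there, so `AEMeasurable f (halfMeasure n)` means that `f` is Lebesgue measurable. -/
def halfMeasure (n : ℕ) : Measure (HalfSpace n) :=
  (gauss n).prod dtOverT

/-- The cutoff function `m(x) = min (1, 1 / |x|)`, with `m(x) = 1` for `|x| ≤ 1`. -/
def cutoff {n : ℕ} (x : E n) : ℝ :=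
  if ‖x‖ ≤ 1 then 1 else 1 / ‖x‖

/-- The radius `αt ∧ m_β(y)`, where `m_β = β m`. -/
def coneRadius {n : ℕ} (α β : ℝ) (p : HalfSpace n) : ℝ :=
  min (α * (p.2 : ℝ)) (β * cutoff p.1)

/-- The Gaussian cone `{(y,t) : |y - x| < αt ∧ m_β(y)}`. -/
def cone {n : ℕ} (α β : ℝ) (x : E n) : Set (HalfSpace n) :=
  {p | ‖p.1 - x‖ < coneRadius α β p}

/-- The Gaussian tent over `O`: the complement of the union of the cones with vertex outside `O`,
that is, the set of `(y,t)` with `|y - x| ≥ αt ∧ m_β(y)` for all `x ∉ O`. -/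
def tent {n : ℕ} (α β : ℝ) (O : Set (E n)) : Set (HalfSpace n) :=
  (⋃ x ∈ Oᶜ, cone α β x)ᶜ

/-- The area function `S_{q,α,β} f`, for `1 ≤ q ≤ ∞`, with values in `[0, ∞]`. -/
def areaFn {n : ℕ} (α β : ℝ) (q : ℝ≥0∞) (f : HalfSpace n → ℝ) (x : E n) : ℝ≥0∞ :=
  if q = ⊤ then ⨆ p ∈ cone α β x, ‖f p‖ₑ
  else (∫⁻ p in cone α β x,
      ‖f p‖ₑ ^ q.toReal / gauss n (Metric.ball p.1 (coneRadius α β p)) ∂(halfMeasure n)) ^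
        (1 / q.toReal)

/-- The norm of `T^{1,q}_{α,β}(γ)`: the `L¹(γ)` norm of the area function, in `[0, ∞]`. -/
def tentNorm {n : ℕ} (α β : ℝ) (q : ℝ≥0∞) (f : HalfSpace n → ℝ) : ℝ≥0∞ :=
  ∫⁻ x, areaFn α β q f x ∂(gauss n)

/-- Membership in the Gaussian tent space `T^{1,q}_{α,β}(γ)`: measurable functions (continuous
ones if `q = ∞`) of finite norm. -/
structure MemTent {n : ℕ} (α β : ℝ) (q : ℝ≥0∞) (f : HalfSpace n → ℝ) : Prop where
  aemeasurable : AEMeasurable f (halfMeasure n)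
  continuous_of_top : q = ⊤ → Continuous f
  norm_lt_top : tentNorm α β q f < ⊤

/-- `a` is a `T^{1,q}_{α,β}(γ)` `δ`-atom: there is a ball `B = B(c,r)` with `0 < r ≤ δ m(c)` such
that `supp a ⊆ T^{α,β}_γ(B)` and `‖a‖_{L^q(dγ dt/t)} ≤ γ(B)^{-(1 - 1/q)}`; for `q = ∞` (where
`1/q = 0`) the function `a` is also required to be continuous. -/
structure IsAtom {n : ℕ} (α β δ : ℝ) (q : ℝ≥0∞) (a : HalfSpace n → ℝ) : Prop where
  aemeasurable : AEMeasurable a (halfMeasure n)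
  continuous_of_top : q = ⊤ → Continuous a
  exists_ball : ∃ (c : E n) (r : ℝ), 0 < r ∧ r ≤ δ * cutoff c ∧
    tsupport a ⊆ tent α β (Metric.ball c r) ∧
    eLpNorm a q (halfMeasure n) ≤ gauss n (Metric.ball c r) ^ (-(1 - (q⁻¹).toReal))

/-- `f = ∑ λ_m a_m`: the partial sums converge to `f` in the norm of `T^{1,q}_{α,β}(γ)`, and the
series converges (absolutely) to `f` at almost every point, at every point if `q = ∞`. -/
structure IsSumOf {n : ℕ} (α β : ℝ) (q : ℝ≥0∞) (lam : ℕ → ℝ) (a : ℕ → HalfSpace n → ℝ)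
    (f : HalfSpace n → ℝ) : Prop where
  tendsto_norm : Tendsto
    (fun N : ℕ => tentNorm α β q (fun p => f p - ∑ m ∈ Finset.range N, lam m * a m p))
    atTop (𝓝 0)
  hasSum_ae : ∀ᵐ p ∂(halfMeasure n), HasSum (fun m => lam m * a m p) (f p)
  hasSum_of_top : q = ⊤ → ∀ p, HasSum (fun m => lam m * a m p) (f p)

end

end GaussTent

/-! Everything is expressed through the shadow `B(y, αt ∧ m_β(y))`: a point lies in the cone of `x`
iff `x` is in its shadow, and in the tent over `O` iff its shadow is inside `O`. Tonelli then gives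
`∫_A S^q dγ = ∫ |f|^q γ(shadow ∩ A) / γ(shadow)` for `q < ∞` (`setLIntegral_area_rpow`). The cutoff
`m` enters through `gauss_ball_le_mul`: at admissible scales the Gaussian density is nearly
constant, so `γ` is doubling there.

Atoms: `S a` vanishes off `B`, so Hölder and Tonelli with `A` the whole space give norm at most one;
for `q = ∞` the sup bound does. Series: Minkowski bounds the area function of `∑ |λ_m a_m|` in `L¹`.
This forces pointwise convergence, almost everywhere for `q < ∞` and locally uniformly for `q = ∞`,
and applied to tails it gives norm convergence.

Decomposition, `q < ∞`: let `L_k = {S f > 2^k}` and let `H_k` be the union of the shadows more than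
half filled by `L_k`; Vitali and doubling give `γ(H_k) ≲ γ(L_k)`. Cut `f` along the decreasing tents
over `H_k`. Off the tent over `H_{k+1}` at least half of each shadow lies where `S f ≤ 2^{k+1}`, so
Tonelli bounds the `k`-th layer on any tent over a ball `B` by `2^{k+2} γ(B)^{1/q}`. For `q = ∞` the
sets `L_k` suffice, and differences of truncations replace indicators to keep the layers continuous.

Each layer is split by a partition of unity in `y` over Whitney balls of radius `w` capped by `m`. A
point of the tent whose `y` is in such a ball has shadow radius `≲ w`, so each piece sits in the
tent over a fixed dilate and is a multiple of an atom. The coefficients sum to `≲ ∑ 2^k γ(H_k) ≲ ∫ S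
f dγ`. The atomic series converges by the converse part, and regrouping it by layers identifies its
sum with `f`. -/

/-- Minkowski's inequality for countable sums of `ℝ≥0∞`-valued functions. -/
lemma ENNReal.lintegral_Lp_tsum_le {X : Type*} [MeasurableSpace X] {ν : Measure X} {p : ℝ}
    (hp : 1 ≤ p) {G : ℕ → X → ℝ≥0∞} (hG : ∀ m, AEMeasurable (G m) ν) :
    (∫⁻ a, (∑' m, G m a) ^ p ∂ν) ^ (1 / p) ≤ ∑' m, (∫⁻ a, G m a ^ p ∂ν) ^ (1 / p) := by
  have hp0 : 0 < p := one_pos.trans_le hp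
  have hfin : ∀ N : ℕ, (∫⁻ a, (∑ m ∈ Finset.range N, G m a) ^ p ∂ν) ^ (1 / p) ≤
      ∑ m ∈ Finset.range N, (∫⁻ a, G m a ^ p ∂ν) ^ (1 / p) := by
    intro N
    induction N with
    | zero => simp [hp0]
    | succ N ih =>
      simp only [Finset.sum_range_succ]
      refine (ENNReal.lintegral_Lp_add_le (Finset.aemeasurable_fun_sum _ fun m _ => hG m)
        (hG N) hp).trans ?_
      gcongr
  have hlim : Tendsto (fun N : ℕ => ∫⁻ a, (∑ m ∈ Finset.range N, G m a) ^ p ∂ν) atTop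
      (𝓝 (∫⁻ a, (∑' m, G m a) ^ p ∂ν)) := by
    refine lintegral_tendsto_of_tendsto_of_monotone
      (fun N => (Finset.aemeasurable_fun_sum _ fun m _ => hG m).pow_const _)
      (ae_of_all _ fun a => ?_) (ae_of_all _ fun a => ?_)
    · intro N N' h
      dsimp only
      gcongr
    · exact ((ENNReal.continuous_rpow_const (y := p)).tendsto _).comp
        (ENNReal.tendsto_nat_tsum fun m => G m a)
  refine le_of_tendsto (((ENNReal.continuous_rpow_const (y := 1 / p)).tendsto _).comp hlim)
    (Eventually.of_forall fun N => (hfin N).trans (ENNReal.sum_le_tsum _))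

namespace GaussTent

variable {n : ℕ}

/-! ### The cutoff function, cones and tents -/

lemma cutoff_eq (x : E n) : cutoff x = (max 1 ‖x‖)⁻¹ := by
  unfold cutoff
  split_ifs with h
  · rw [max_eq_left h, inv_one]
  · rw [max_eq_right (not_le.1 h).le, one_div]

lemma cutoff_pos (x : E n) : 0 < cutoff x := by
  rw [cutoff_eq]; positivity

lemma cutoff_le_one (x : E n) : cutoff x ≤ 1 := by
  rw [cutoff_eq]; exact inv_le_one_of_one_le₀ (le_max_left _ _)

lemma cutoff_mul_norm_le (x : E n) : cutoff x * ‖x‖ ≤ 1 := by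
  rw [cutoff_eq]
  exact inv_mul_le_one_of_le₀ (le_max_right _ _) (by positivity)

lemma continuous_cutoff : Continuous (cutoff : E n → ℝ) := by
  have : (cutoff : E n → ℝ) = fun x => (max 1 ‖x‖)⁻¹ := funext cutoff_eq
  rw [this]
  exact (continuous_const.max continuous_norm).inv₀ fun x => by positivity

lemma cutoff_le_two_mul {x y : E n} (h : ‖x - y‖ ≤ 1) : cutoff x ≤ 2 * cutoff y := by
  rw [cutoff_eq, cutoff_eq, ← div_eq_mul_inv, inv_le_comm₀ (by positivity) (by positivity),
    inv_div, div_le_iff₀ two_pos]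
  have h1 : ‖y‖ ≤ ‖x‖ + ‖x - y‖ := by
    rw [norm_sub_rev]; exact norm_le_norm_add_norm_sub' y x
  have h2 := le_max_left 1 ‖x‖
  have h3 := le_max_right 1 ‖x‖
  exact max_le (by linarith) (by linarith)

lemma coneRadius_pos {α β : ℝ} (hα : 0 < α) (hβ : 0 < β) (p : HalfSpace n) :
    0 < coneRadius α β p :=
  lt_min (mul_pos hα p.2.2) (mul_pos hβ (cutoff_pos _))

lemma coneRadius_le (α β : ℝ) (p : HalfSpace n) : coneRadius α β p ≤ β * cutoff p.1 :=
  min_le_right _ _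

lemma continuous_coneRadius (α β : ℝ) : Continuous (coneRadius α β : HalfSpace n → ℝ) :=
  (continuous_const.mul (continuous_subtype_val.comp continuous_snd)).min
    (continuous_const.mul (continuous_cutoff.comp continuous_fst))

/-- The ball `B(y, αt ∧ m_β(y))` of all vertices whose cone contains `(y, t)`. -/
abbrev shadow (α β : ℝ) (p : HalfSpace n) : Set (E n) := Metric.ball p.1 (coneRadius α β p)

lemma mem_cone_iff {α β : ℝ} {x : E n} {p : HalfSpace n} :
    p ∈ cone α β x ↔ x ∈ shadow α β p := by
  rw [Metric.mem_ball, dist_comm, dist_eq_norm]; rfl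

/-- Supplies the joint measurability in vertex and point needed for Tonelli. -/
lemma isOpen_incidence (α β : ℝ) : IsOpen {z : E n × HalfSpace n | z.1 ∈ shadow α β z.2} :=
  isOpen_lt (continuous_fst.dist (continuous_fst.comp continuous_snd))
    ((continuous_coneRadius α β).comp continuous_snd)

lemma isOpen_cone (α β : ℝ) (x : E n) : IsOpen (cone α β x) := by
  have : cone α β x = (fun p => (x, p)) ⁻¹' {z : E n × HalfSpace n | z.1 ∈ shadow α β z.2} := by
    ext p; exact mem_cone_iff
  rw [this]
  exact (isOpen_incidence α β).preimage (by fun_prop)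

lemma mem_tent_iff {α β : ℝ} {O : Set (E n)} {p : HalfSpace n} :
    p ∈ tent α β O ↔ shadow α β p ⊆ O := by
  simp only [tent, Set.mem_compl_iff, Set.mem_iUnion, mem_cone_iff, not_exists]
  exact ⟨fun h x hx => by_contra fun hO => h x hO hx, fun h x hO hx => hO (h hx)⟩

lemma isClosed_tent (α β : ℝ) (O : Set (E n)) : IsClosed (tent α β O) :=
  (isOpen_biUnion fun x _ => isOpen_cone α β x).isClosed_compl

lemma tent_mono {α β : ℝ} {O O' : Set (E n)} (h : O ⊆ O') : tent α β O ⊆ tent α β O' :=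
  fun _ hp => mem_tent_iff.2 ((mem_tent_iff.1 hp).trans h)

/-! ### The Gaussian measure -/

instance : SFinite (gauss n) := by unfold gauss; infer_instance

instance : SFinite dtOverT := by
  have : IsFiniteMeasureOnCompacts (Measure.comap ((↑) : Set.Ioi (0 : ℝ) → ℝ) volume) :=
    .comap' _ continuous_subtype_val (MeasurableEmbedding.subtype_coe measurableSet_Ioi)
  have : LocallyCompactSpace (Set.Ioi (0 : ℝ)) := isOpen_Ioi.locallyCompactSpace
  have : SigmaFinite (Measure.comap ((↑) : Set.Ioi (0 : ℝ) → ℝ) volume) := inferInstance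
  unfold dtOverT
  infer_instance

instance : SFinite (halfMeasure n) := by unfold halfMeasure; infer_instance

lemma measurable_gaussDensity :
    Measurable fun y : E n => ENNReal.ofReal (Real.exp (-‖y‖ ^ 2)) := by fun_prop

instance : (gauss n).IsOpenPosMeasure := by
  refine (withDensity_absolutelyContinuous' (μ := (volume : Measure (E n)))
    measurable_gaussDensity.aemeasurable (ae_of_all _ fun y => ?_)).isOpenPosMeasure
  simpa using Real.exp_pos _

instance : dtOverT.IsOpenPosMeasure := by
  have h : (Measure.comap ((↑) : Set.Ioi (0 : ℝ) → ℝ) volume).IsOpenPosMeasure := by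
    refine ⟨fun U hU hne => ?_⟩
    rw [(MeasurableEmbedding.subtype_coe measurableSet_Ioi).comap_apply]
    exact ((isOpen_Ioi.isOpenMap_subtype_val U hU).measure_pos _ (hne.image _)).ne'
  have hd : Measurable fun t : Set.Ioi (0 : ℝ) => ENNReal.ofReal (1 / (t : ℝ)) := by fun_prop
  refine (withDensity_absolutelyContinuous' hd.aemeasurable
    (ae_of_all _ fun t => ?_)).isOpenPosMeasure
  simpa using Set.mem_Ioi.1 t.2

/-- For `q = ∞` this turns an essential bound on a continuous function into a bound at every point.
-/
instance : (halfMeasure n).IsOpenPosMeasure := by unfold halfMeasure; infer_instance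

lemma gauss_ball_lt_top (c : E n) (r : ℝ) : gauss n (Metric.ball c r) < ⊤ := by
  refine lt_of_le_of_lt ?_ (measure_ball_lt_top (μ := (volume : Measure (E n))) (x := c) (r := r))
  rw [gauss, withDensity_apply _ measurableSet_ball]
  refine (setLIntegral_mono measurable_const (g := fun _ => 1) fun y _ => ?_).trans (by simp)
  rw [ENNReal.ofReal_le_one]
  exact Real.exp_le_one_iff.2 (by nlinarith [sq_nonneg ‖y‖])

lemma gauss_ball_pos (c : E n) {r : ℝ} (hr : 0 < r) : 0 < gauss n (Metric.ball c r) :=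
  Metric.measure_ball_pos _ c hr

/-- The difference is at most `R (2|c| + R)`, and `R|c| ≤ A` because `m(c)|c| ≤ 1`. Hence the
Gaussian density oscillates by a bounded factor on admissible balls. -/
lemma abs_sq_norm_sub_le {A R : ℝ} {c y : E n} (hA : R ≤ A * cutoff c)
    (hy : y ∈ Metric.ball c R) : |‖y‖ ^ 2 - ‖c‖ ^ 2| ≤ A * (2 + A) := by
  rw [Metric.mem_ball, dist_eq_norm] at hy
  have h0 : 0 ≤ ‖y - c‖ := norm_nonneg _
  have hm := cutoff_pos c
  have hA0 : 0 < A := by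
    by_contra h
    nlinarith
  have h1 : |‖y‖ - ‖c‖| ≤ ‖y - c‖ := abs_norm_sub_norm_le y c
  have h2 : ‖y‖ + ‖c‖ ≤ 2 * ‖c‖ + R := by
    have := (abs_le.1 h1).2
    linarith
  have hR : R ≤ A := hA.trans (by nlinarith [cutoff_le_one c])
  have h3 : ‖c‖ * R ≤ A := by
    have := mul_le_mul_of_nonneg_left hA (norm_nonneg c)
    nlinarith [cutoff_mul_norm_le c]
  rw [show ‖y‖ ^ 2 - ‖c‖ ^ 2 = (‖y‖ - ‖c‖) * (‖y‖ + ‖c‖) by ring, abs_mul,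
    abs_of_nonneg (add_nonneg (norm_nonneg y) (norm_nonneg c))]
  calc |‖y‖ - ‖c‖| * (‖y‖ + ‖c‖) ≤ R * (2 * ‖c‖ + R) := by
        gcongr
        · exact h0.trans hy.le
        · exact h1.trans hy.le
    _ ≤ A * (2 + A) := by nlinarith

/-- The Gaussian measure is doubling on balls of admissible radius. -/
lemma gauss_ball_le_mul {A R r : ℝ} {c : E n} (hA : 1 ≤ A) (hrm : r ≤ A * cutoff c)
    (hRm : R ≤ A * cutoff c) (hRr : R ≤ A * r) :
    gauss n (Metric.ball c R) ≤
      ENNReal.ofReal (Real.exp (2 * (A * (2 + A))) * A ^ n) * gauss n (Metric.ball c r) := by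
  -- Replacing the density by its value at `c` costs `e^D` on each of the two balls; Lebesgue
  -- scaling costs `A ^ n`.
  set D := A * (2 + A)
  have hup : gauss n (Metric.ball c R) ≤
      ENNReal.ofReal (Real.exp (-‖c‖ ^ 2 + D)) * volume (Metric.ball c R) := by
    rw [gauss, withDensity_apply _ measurableSet_ball, ← setLIntegral_const]
    refine setLIntegral_mono measurable_const fun y hy => ?_
    have := (abs_le.1 (abs_sq_norm_sub_le hRm hy)).1
    exact ENNReal.ofReal_le_ofReal (Real.exp_le_exp.2 (by linarith))
  have hlow : ENNReal.ofReal (Real.exp (-‖c‖ ^ 2 - D)) * volume (Metric.ball c r) ≤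
      gauss n (Metric.ball c r) := by
    rw [gauss, withDensity_apply _ measurableSet_ball, ← setLIntegral_const]
    refine setLIntegral_mono measurable_gaussDensity fun y hy => ?_
    have := (abs_le.1 (abs_sq_norm_sub_le hrm hy)).2
    exact ENNReal.ofReal_le_ofReal (Real.exp_le_exp.2 (by linarith))
  have hvol : volume (Metric.ball c R) ≤ ENNReal.ofReal (A ^ n) * volume (Metric.ball c r) := by
    refine (measure_mono (Metric.ball_subset_ball hRr)).trans (le_of_eq ?_)
    rw [Measure.addHaar_ball_mul_of_pos _ _ (by linarith), finrank_euclideanSpace_fin,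
      Measure.addHaar_ball_center, Measure.addHaar_ball_center volume c]
  calc gauss n (Metric.ball c R)
      ≤ ENNReal.ofReal (Real.exp (-‖c‖ ^ 2 + D)) *
          (ENNReal.ofReal (A ^ n) * volume (Metric.ball c r)) := hup.trans (by gcongr)
    _ = ENNReal.ofReal (Real.exp (2 * D) * A ^ n) *
          (ENNReal.ofReal (Real.exp (-‖c‖ ^ 2 - D)) * volume (Metric.ball c r)) := by
        rw [← mul_assoc, ← mul_assoc, ← ENNReal.ofReal_mul (by positivity),
          ← ENNReal.ofReal_mul (by positivity)]
        congr 2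
        rw [mul_right_comm, ← Real.exp_add]
        congr 2
        ring
    _ ≤ _ := by gcongr

variable {α β : ℝ} {q : ℝ≥0∞}

/-! ### The area functional on nonnegative functions -/

/-- The area functional `S_{q,α,β}` on `[0, ∞]`-valued functions. -/
noncomputable def area (α β : ℝ) (q : ℝ≥0∞) (G : HalfSpace n → ℝ≥0∞) (x : E n) : ℝ≥0∞ :=
  if q = ⊤ then ⨆ p ∈ cone α β x, G p
  else (∫⁻ p in cone α β x, G p ^ q.toReal / gauss n (shadow α β p) ∂(halfMeasure n)) ^
    (1 / q.toReal)

lemma areaFn_eq_area (f : HalfSpace n → ℝ) :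
    areaFn α β q f = area α β q fun p => ‖f p‖ₑ := rfl

lemma area_top (G : HalfSpace n → ℝ≥0∞) (x : E n) :
    area α β ⊤ G x = ⨆ p ∈ cone α β x, G p := if_pos rfl

lemma area_of_ne_top (h : q ≠ ⊤) (G : HalfSpace n → ℝ≥0∞) (x : E n) :
    area α β q G x = (∫⁻ p in cone α β x, G p ^ q.toReal / gauss n (shadow α β p)
      ∂(halfMeasure n)) ^ (1 / q.toReal) := if_neg h

lemma one_le_toReal (hq : 1 ≤ q) (h : q ≠ ⊤) : 1 ≤ q.toReal := by
  simpa using ENNReal.toReal_mono h hq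

lemma toReal_pos_of_one_le (hq : 1 ≤ q) (h : q ≠ ⊤) : 0 < q.toReal :=
  one_pos.trans_le (one_le_toReal hq h)

lemma measurable_gauss_shadow : Measurable fun p : HalfSpace n => gauss n (shadow α β p) := by
  have h : Measurable fun p : HalfSpace n =>
      gauss n ((fun x => (x, p)) ⁻¹' {z : E n × HalfSpace n | z.1 ∈ shadow α β z.2}) :=
    measurable_measure_prodMk_right (isOpen_incidence α β).measurableSet
  exact h

lemma gauss_shadow_ne_zero (hα : 0 < α) (hβ : 0 < β) (p : HalfSpace n) :
    gauss n (shadow α β p) ≠ 0 := (gauss_ball_pos _ (coneRadius_pos hα hβ p)).ne'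

lemma gauss_shadow_ne_top (p : HalfSpace n) : gauss n (shadow α β p) ≠ ⊤ :=
  (gauss_ball_lt_top _ _).ne

lemma area_mono {G H : HalfSpace n → ℝ≥0∞} (h : ∀ p, G p ≤ H p) (x : E n) :
    area α β q G x ≤ area α β q H x := by
  unfold area
  split_ifs
  · exact iSup₂_mono fun p _ => h p
  · gcongr with p
    exact h p

/-- At `q = ⊤` the supremum sees null sets, which is why pointwise hypotheses are carried separately
in that case. -/
lemma area_congr_ae (h : q ≠ ⊤) {G H : HalfSpace n → ℝ≥0∞} (hGH : G =ᵐ[halfMeasure n] H)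
    (x : E n) : area α β q G x = area α β q H x := by
  rw [area_of_ne_top h, area_of_ne_top h]
  congr 1
  refine lintegral_congr_ae ((ae_restrict_of_ae hGH).mono fun p hp => ?_)
  simp only [hp]

lemma area_const_mul (hq : 1 ≤ q) {c : ℝ≥0∞} (hc : c ≠ ⊤) (G : HalfSpace n → ℝ≥0∞) (x : E n) :
    area α β q (fun p => c * G p) x = c * area α β q G x := by
  by_cases h : q = ⊤
  · subst h
    simp only [area_top, ENNReal.mul_iSup]
  · have hq0 := toReal_pos_of_one_le hq h
    simp only [area_of_ne_top h, ENNReal.mul_rpow_of_nonneg _ _ hq0.le, mul_div_assoc]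
    rw [lintegral_const_mul' _ _ (by simp [hc, hq0.le]),
      ENNReal.mul_rpow_of_nonneg _ _ (by positivity), ← ENNReal.rpow_mul,
      mul_one_div_cancel hq0.ne', ENNReal.rpow_one]

lemma area_tsum_le (hq : 1 ≤ q) {G : ℕ → HalfSpace n → ℝ≥0∞}
    (hG : ∀ m, AEMeasurable (G m) (halfMeasure n)) (x : E n) :
    area α β q (fun p => ∑' m, G m p) x ≤ ∑' m, area α β q (G m) x := by
  by_cases h : q = ⊤
  · subst h
    simp only [area_top]
    exact iSup₂_le fun p hp => ENNReal.tsum_le_tsum fun m => le_iSup₂_of_le p hp le_rfl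
  · have hq0 := toReal_pos_of_one_le hq h
    -- The weight is absorbed as its `1/q`-th power, so that the area becomes a plain `L^q` norm and
    -- Minkowski applies.
    have key : ∀ H : HalfSpace n → ℝ≥0∞, area α β q H x = (∫⁻ p in cone α β x,
        (H p * (gauss n (shadow α β p))⁻¹ ^ (1 / q.toReal)) ^ q.toReal
          ∂(halfMeasure n)) ^ (1 / q.toReal) := by
      intro H
      rw [area_of_ne_top h]
      simp only [ENNReal.mul_rpow_of_nonneg _ _ hq0.le, ← ENNReal.rpow_mul,
        one_div_mul_cancel hq0.ne', ENNReal.rpow_one]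
      rfl
    simp only [key, ← ENNReal.tsum_mul_right]
    exact ENNReal.lintegral_Lp_tsum_le (one_le_toReal hq h) fun m =>
      (hG m).restrict.mul (measurable_gauss_shadow.inv.pow_const _).aemeasurable

/-! ### Integration over cones -/

lemma lintegral_cone_eq (H : HalfSpace n → ℝ≥0∞) (x : E n) :
    ∫⁻ p in cone α β x, H p ∂(halfMeasure n) =
      ∫⁻ p, {z : E n × HalfSpace n | z.1 ∈ shadow α β z.2}.indicator (fun z => H z.2) (x, p)
        ∂(halfMeasure n) := by
  rw [← lintegral_indicator (isOpen_cone α β x).measurableSet]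
  refine lintegral_congr fun p => ?_
  by_cases h : p ∈ cone α β x
  · rw [Set.indicator_of_mem h, Set.indicator_of_mem (by exact mem_cone_iff.1 h)]
  · rw [Set.indicator_of_notMem h, Set.indicator_of_notMem (by exact fun h' => h (mem_cone_iff.2 h'))]

lemma measurable_lintegral_cone {H : HalfSpace n → ℝ≥0∞} (hH : AEMeasurable H (halfMeasure n)) :
    Measurable fun x : E n => ∫⁻ p in cone α β x, H p ∂(halfMeasure n) := by
  have : (fun x : E n => ∫⁻ p in cone α β x, H p ∂(halfMeasure n)) =
      fun x => ∫⁻ p in cone α β x, hH.mk H p ∂(halfMeasure n) :=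
    funext fun x => lintegral_congr_ae (ae_restrict_of_ae hH.ae_eq_mk)
  rw [this]
  simp only [lintegral_cone_eq]
  exact ((hH.measurable_mk.comp measurable_snd).indicator
    (isOpen_incidence α β).measurableSet).lintegral_prod_right'

/-- Tonelli: for fixed `p`, the vertices whose cone contains `p` form the shadow. The set `A` will
be a place where the area function is small. -/
lemma lintegral_lintegral_cone {H : HalfSpace n → ℝ≥0∞} (hH : AEMeasurable H (halfMeasure n))
    (A : Set (E n)) :
    ∫⁻ x in A, ∫⁻ p in cone α β x, H p ∂(halfMeasure n) ∂(gauss n) =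
      ∫⁻ p, H p * gauss n (shadow α β p ∩ A) ∂(halfMeasure n) := by
  simp only [lintegral_cone_eq]
  rw [lintegral_lintegral_swap]
  · refine lintegral_congr fun p => ?_
    have : (fun x : E n => {z : E n × HalfSpace n | z.1 ∈ shadow α β z.2}.indicator
        (fun z => H z.2) (x, p)) = (shadow α β p).indicator fun _ => H p := by
      ext x
      simp only [Set.indicator, Set.mem_ofPred_eq]
    rw [this, lintegral_indicator measurableSet_ball, setLIntegral_const,
      Measure.restrict_apply measurableSet_ball]
  · exact (hH.comp_snd.indicator (isOpen_incidence α β).measurableSet)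

lemma measurable_area {G : HalfSpace n → ℝ≥0∞} (hG : AEMeasurable G (halfMeasure n)) :
    Measurable (area α β q G) := by
  by_cases h : q = ⊤
  · subst h
    refine measurable_of_Ioi fun c => ?_
    -- Superlevel sets are unions of shadows, hence open whatever `G` is.
    have : area α β ⊤ G ⁻¹' Set.Ioi c = ⋃ p ∈ {p | c < G p}, shadow α β p := by
      ext x
      simp only [Set.mem_preimage, area_top, Set.mem_Ioi, lt_iSup_iff, Set.mem_iUnion,
        mem_cone_iff, Set.mem_ofPred_eq, exists_prop, and_comm]
    rw [this]
    exact (isOpen_biUnion fun p _ => Metric.isOpen_ball).measurableSet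
  · have : area α β q G = fun x => (∫⁻ p in cone α β x, G p ^ q.toReal / gauss n (shadow α β p)
        ∂(halfMeasure n)) ^ (1 / q.toReal) := funext fun x => area_of_ne_top h G x
    rw [this]
    exact (measurable_lintegral_cone ((hG.pow_const _).div
      measurable_gauss_shadow.aemeasurable)).pow_const _

lemma setLIntegral_area_rpow (hq : 1 ≤ q) (h : q ≠ ⊤) {G : HalfSpace n → ℝ≥0∞}
    (hG : AEMeasurable G (halfMeasure n)) (A : Set (E n)) :
    ∫⁻ x in A, area α β q G x ^ q.toReal ∂(gauss n) =
      ∫⁻ p, G p ^ q.toReal / gauss n (shadow α β p) * gauss n (shadow α β p ∩ A)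
        ∂(halfMeasure n) := by
  have hq0 := toReal_pos_of_one_le hq h
  simp only [area_of_ne_top h, ← ENNReal.rpow_mul, one_div_mul_cancel hq0.ne', ENNReal.rpow_one]
  exact lintegral_lintegral_cone ((hG.pow_const _).div
      measurable_gauss_shadow.aemeasurable) A

lemma lintegral_area_rpow (hα : 0 < α) (hβ : 0 < β) (hq : 1 ≤ q) (h : q ≠ ⊤)
    {G : HalfSpace n → ℝ≥0∞} (hG : AEMeasurable G (halfMeasure n)) :
    ∫⁻ x, area α β q G x ^ q.toReal ∂(gauss n) = ∫⁻ p, G p ^ q.toReal ∂(halfMeasure n) := by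
  rw [← setLIntegral_univ, setLIntegral_area_rpow hq h hG]
  refine lintegral_congr fun p => ?_
  rw [Set.inter_univ, ENNReal.div_mul_cancel (gauss_shadow_ne_zero hα hβ p)
    (gauss_shadow_ne_top p)]

lemma area_eq_zero_of_support_subset (hq : 1 ≤ q) {G : HalfSpace n → ℝ≥0∞} {O : Set (E n)}
    (hG : ∀ p, p ∉ tent α β O → G p = 0) {x : E n} (hx : x ∉ O) : area α β q G x = 0 := by
  have h0 : ∀ p ∈ cone α β x, G p = 0 := fun p hp =>
    hG p fun ht => hx (mem_tent_iff.1 ht (mem_cone_iff.1 hp))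
  by_cases h : q = ⊤
  · subst h
    simp only [area_top, ENNReal.iSup_eq_zero]
    exact h0
  · have hq0 := toReal_pos_of_one_le hq h
    rw [area_of_ne_top h, setLIntegral_congr_fun (g := fun _ => 0)
      (isOpen_cone α β x).measurableSet]
    · simp [hq0]
    · intro p hp
      simp [h0 p hp, hq0]

/-- A bounded-support estimate: if `G` lives on the tent over `O`, then its `T^{1,q}` norm is at
most `γ(O)^{1-1/q} ‖G‖_q`. -/
lemma lintegral_area_le_of_support_subset (hα : 0 < α) (hβ : 0 < β) (hq : 1 ≤ q) (h : q ≠ ⊤)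
    {G : HalfSpace n → ℝ≥0∞} (hGm : AEMeasurable G (halfMeasure n)) {O : Set (E n)}
    (hO : MeasurableSet O) (hG : ∀ p, p ∉ tent α β O → G p = 0) :
    ∫⁻ x, area α β q G x ∂(gauss n) ≤
      (∫⁻ p, G p ^ q.toReal ∂(halfMeasure n)) ^ (1 / q.toReal) *
        gauss n O ^ (1 - 1 / q.toReal) := by
  have hq0 := toReal_pos_of_one_le hq h
  have h1 : ∫⁻ x, area α β q G x ∂(gauss n) = ∫⁻ x in O, area α β q G x ∂(gauss n) := by
    rw [← lintegral_indicator hO]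
    refine lintegral_congr fun x => ?_
    by_cases hx : x ∈ O
    · rw [Set.indicator_of_mem hx]
    · rw [Set.indicator_of_notMem hx, area_eq_zero_of_support_subset hq hG hx]
  -- Hölder on `O`, comparing the exponents `1` and `q`.
  have h2 := eLpNorm'_le_eLpNorm'_mul_rpow_measure_univ (μ := (gauss n).restrict O)
    (f := area α β q G) one_pos (one_le_toReal hq h) (measurable_area hGm).aestronglyMeasurable
  simp only [eLpNorm', enorm_eq_self, ENNReal.rpow_one, div_one, Measure.restrict_apply_univ] at h2
  rw [h1]
  refine h2.trans ?_
  gcongr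
  rw [← lintegral_area_rpow hα hβ hq h hGm]
  exact setLIntegral_le_lintegral _ _

/-! ### Atoms -/

lemma tentNorm_eq_lintegral_area (f : HalfSpace n → ℝ) :
    tentNorm α β q f = ∫⁻ x, area α β q (fun p => ‖f p‖ₑ) x ∂(gauss n) := rfl

/-- The set where `a` exceeds its essential supremum is open and null, hence empty. -/
lemma enorm_le_eLpNorm_top {a : HalfSpace n → ℝ} (ha : Continuous a) (p : HalfSpace n) :
    ‖a p‖ₑ ≤ eLpNorm a ⊤ (halfMeasure n) := by
  by_contra hp
  have hopen : IsOpen {p | eLpNorm a ⊤ (halfMeasure n) < ‖a p‖ₑ} :=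
    isOpen_lt continuous_const ha.enorm
  have hnull : halfMeasure n {p | eLpNorm a ⊤ (halfMeasure n) < ‖a p‖ₑ} = 0 := by
    have h := ae_le_eLpNormEssSup (f := a) (μ := halfMeasure n)
    rw [ae_iff] at h
    simpa only [not_le, eLpNorm_exponent_top] using h
  exact Set.eq_empty_iff_forall_notMem.1 ((hopen.measure_eq_zero_iff _).1 hnull) p (not_le.1 hp)

lemma IsAtom.tentNorm_le_one {δ : ℝ} {a : HalfSpace n → ℝ} (hα : 0 < α) (hβ : 0 < β)
    (hq : 1 ≤ q) (ha : IsAtom α β δ q a) : tentNorm α β q a ≤ 1 := by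
  obtain ⟨c, r, hr, -, hsupp, hnorm⟩ := ha.exists_ball
  have hγ0 := (gauss_ball_pos c hr).ne'
  have hγt := (gauss_ball_lt_top c r).ne
  have h0 : ∀ p, p ∉ tent α β (Metric.ball c r) → ‖a p‖ₑ = 0 := fun p hp => by
    rw [enorm_eq_zero]
    by_contra h
    exact hp (hsupp (subset_tsupport a h))
  rw [tentNorm_eq_lintegral_area]
  by_cases h : q = ⊤
  · subst h
    have hle : ∀ x, area α β ⊤ (fun p => ‖a p‖ₑ) x ≤
        (Metric.ball c r).indicator (fun _ => (gauss n (Metric.ball c r))⁻¹) x := by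
      intro x
      by_cases hx : x ∈ Metric.ball c r
      · rw [Set.indicator_of_mem hx, area_top]
        refine iSup₂_le fun p _ => (enorm_le_eLpNorm_top (ha.continuous_of_top rfl) p).trans ?_
        simpa [ENNReal.rpow_neg_one] using hnorm
      · rw [area_eq_zero_of_support_subset hq h0 hx]
        exact zero_le
    refine (lintegral_mono hle).trans ?_
    rw [lintegral_indicator measurableSet_ball, setLIntegral_const, ENNReal.inv_mul_cancel hγ0 hγt]
  · refine (lintegral_area_le_of_support_subset hα hβ hq h ha.aemeasurable.enorm
      measurableSet_ball h0).trans ?_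
    rw [eLpNorm_eq_lintegral_rpow_enorm_toReal (one_pos.trans_le hq).ne' h] at hnorm
    refine (mul_le_mul_left hnorm _).trans ?_
    rw [ENNReal.toReal_inv, one_div, ← ENNReal.rpow_add _ _ hγ0 hγt, neg_add_cancel,
      ENNReal.rpow_zero]

lemma IsAtom.memTent {δ : ℝ} {a : HalfSpace n → ℝ} (hα : 0 < α) (hβ : 0 < β)
    (hq : 1 ≤ q) (ha : IsAtom α β δ q a) : MemTent α β q a :=
  ⟨ha.aemeasurable, ha.continuous_of_top,
    (ha.tentNorm_le_one hα hβ hq).trans_lt ENNReal.one_lt_top⟩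

/-! ### Absolutely convergent series in the tent space -/

lemma lintegral_area_tsum_le (hq : 1 ≤ q) {lam : ℕ → ℝ} {a : ℕ → HalfSpace n → ℝ}
    (hm : ∀ m, AEMeasurable (a m) (halfMeasure n)) (ha : ∀ m, tentNorm α β q (a m) ≤ 1) :
    ∫⁻ x, area α β q (fun p => ∑' m, ‖lam m * a m p‖ₑ) x ∂(gauss n) ≤ ∑' m, ‖lam m‖ₑ := by
  have hm' : ∀ m, AEMeasurable (fun p => ‖lam m * a m p‖ₑ) (halfMeasure n) :=
    fun m => ((hm m).const_mul _).enorm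
  calc ∫⁻ x, area α β q (fun p => ∑' m, ‖lam m * a m p‖ₑ) x ∂(gauss n)
      ≤ ∫⁻ x, ∑' m, area α β q (fun p => ‖lam m * a m p‖ₑ) x ∂(gauss n) :=
        lintegral_mono fun x => area_tsum_le hq hm' x
    _ = ∑' m, ∫⁻ x, area α β q (fun p => ‖lam m * a m p‖ₑ) x ∂(gauss n) :=
        lintegral_tsum fun m => (measurable_area (hm' m)).aemeasurable
    _ ≤ ∑' m, ‖lam m‖ₑ := by
        refine ENNReal.tsum_le_tsum fun m => ?_
        simp only [enorm_mul, area_const_mul hq enorm_ne_top]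
        rw [lintegral_const_mul' _ _ enorm_ne_top]
        exact mul_le_of_le_one_right' (ha m)

lemma tentNorm_le_of_ae_le {f : HalfSpace n → ℝ} {G : HalfSpace n → ℝ≥0∞}
    (hf : ∀ᵐ p ∂(halfMeasure n), ‖f p‖ₑ ≤ G p)
    (htop : q = ⊤ → ∀ p, ‖f p‖ₑ ≤ G p) :
    tentNorm α β q f ≤ ∫⁻ x, area α β q G x ∂(gauss n) := by
  rw [tentNorm_eq_lintegral_area]
  refine lintegral_mono fun x => ?_
  by_cases h : q = ⊤
  · exact area_mono (htop h) x
  -- Enlarging `G` on a null set makes the domination hold everywhere.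
  · have : G =ᵐ[halfMeasure n] fun p => max ‖f p‖ₑ (G p) :=
      hf.mono fun p hp => (max_eq_right hp).symm
    rw [area_congr_ae h this]
    exact area_mono (fun p => le_max_left _ _) x

lemma tentNorm_le_of_hasSum (hq : 1 ≤ q) {lam : ℕ → ℝ} {a : ℕ → HalfSpace n → ℝ}
    {f : HalfSpace n → ℝ} (hm : ∀ m, AEMeasurable (a m) (halfMeasure n))
    (ha : ∀ m, tentNorm α β q (a m) ≤ 1)
    (hae : ∀ᵐ p ∂(halfMeasure n), HasSum (fun m => lam m * a m p) (f p))
    (htop : q = ⊤ → ∀ p, HasSum (fun m => lam m * a m p) (f p)) :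
    tentNorm α β q f ≤ ∑' m, ‖lam m‖ₑ := by
  have key : ∀ p, HasSum (fun m => lam m * a m p) (f p) →
      ‖f p‖ₑ ≤ ∑' m, ‖lam m * a m p‖ₑ := fun p hp => by
    rw [← hp.tsum_eq]; exact enorm_tsum_le_tsum_enorm
  exact (tentNorm_le_of_ae_le (hae.mono key) fun h p => key p (htop h p)).trans
    (lintegral_area_tsum_le hq hm ha)

lemma tsum_enorm_eq_ofReal {lam : ℕ → ℝ} (hlam : Summable fun m => |lam m|) :
    ∑' m, ‖lam m‖ₑ = ENNReal.ofReal (∑' m, |lam m|) := by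
  rw [ENNReal.ofReal_tsum_of_nonneg (fun m => abs_nonneg _) hlam]
  simp only [Real.enorm_eq_ofReal_abs]

lemma isSumOf_of_hasSum (hq : 1 ≤ q) {lam : ℕ → ℝ} {a : ℕ → HalfSpace n → ℝ}
    {f : HalfSpace n → ℝ} (hlam : Summable fun m => |lam m|)
    (hm : ∀ m, AEMeasurable (a m) (halfMeasure n))
    (ha : ∀ m, tentNorm α β q (a m) ≤ 1)
    (hae : ∀ᵐ p ∂(halfMeasure n), HasSum (fun m => lam m * a m p) (f p))
    (htop : q = ⊤ → ∀ p, HasSum (fun m => lam m * a m p) (f p)) :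
    IsSumOf α β q lam a f := by
  refine ⟨?_, hae, htop⟩
  have hfin : ∑' m, ‖lam m‖ₑ ≠ ⊤ := by rw [tsum_enorm_eq_ofReal hlam]; exact ENNReal.ofReal_ne_top
  refine tendsto_of_tendsto_of_tendsto_of_le_of_le tendsto_const_nhds
    (ENNReal.tendsto_sum_nat_add (fun m => ‖lam m‖ₑ) hfin) (fun _ => zero_le) fun N => ?_
  -- The remainder is the series with shifted data, so its norm is at most the tail of `∑ |λ_m|`.
  exact tentNorm_le_of_hasSum (lam := fun m => lam (m + N)) (a := fun m => a (m + N)) hq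
    (fun m => hm _) (fun m => ha _) (hae.mono fun p hp => (hasSum_nat_add_iff' N).2 hp)
    fun h p => (hasSum_nat_add_iff' N).2 (htop h p)

/-- The indicator `H` of `{G = ∞}` satisfies `k H ≤ G` for every `k`, so its area function vanishes
wherever that of `G` is finite; Tonelli then gives `∫ H^q = 0`. -/
lemma ae_lt_top_of_lintegral_area (hα : 0 < α) (hβ : 0 < β) (hq : 1 ≤ q) (h : q ≠ ⊤)
    {G : HalfSpace n → ℝ≥0∞} (hG : AEMeasurable G (halfMeasure n))
    (hfin : ∫⁻ x, area α β q G x ∂(gauss n) ≠ ⊤) : ∀ᵐ p ∂(halfMeasure n), G p < ⊤ := by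
  have hq0 := toReal_pos_of_one_le hq h
  set H : HalfSpace n → ℝ≥0∞ := fun p => ({⊤} : Set ℝ≥0∞).indicator (fun _ => 1) (G p) with hH
  have hHm : AEMeasurable H (halfMeasure n) :=
    (measurable_const.indicator (measurableSet_singleton _)).comp_aemeasurable hG
  have hHG : ∀ (k : ℕ) p, k * H p ≤ G p := fun k p => by
    by_cases hp : G p = ⊤
    · simp [hp]
    · simp [hH, hp]
  have hzero : ∀ᵐ x ∂(gauss n), area α β q H x ^ q.toReal = 0 := by
    filter_upwards [ae_lt_top (measurable_area hG) hfin] with x hx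
    have : area α β q H x = 0 := by
      by_contra hne
      obtain ⟨k, hk⟩ := ENNReal.exists_nat_mul_gt hne hx.ne
      rw [← area_const_mul hq (ENNReal.natCast_ne_top k)] at hk
      exact hk.not_ge (area_mono (hHG k) x)
    simp [this, hq0]
  have hint := lintegral_area_rpow hα hβ hq h hHm
  rw [lintegral_congr_ae hzero, lintegral_zero, eq_comm,
    lintegral_eq_zero_iff' (hHm.pow_const _)] at hint
  filter_upwards [hint] with p hp
  by_contra hne
  simp [hH, not_lt_top_iff.1 hne] at hp

/-- Near every point of the half-space, values are controlled by the `T^{1,∞}` norm. -/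
lemma exists_nhds_mul_le_lintegral_area (hα : 0 < α) (hβ : 0 < β) (p₀ : HalfSpace n) :
    ∃ U ∈ 𝓝 p₀, ∃ M : ℝ≥0∞, M ≠ ⊤ ∧ ∀ (G : HalfSpace n → ℝ≥0∞), ∀ p ∈ U,
      G p ≤ M * ∫⁻ x, area α β ⊤ G x ∂(gauss n) := by
  set r := coneRadius α β p₀ / 2
  have hr : 0 < r := half_pos (coneRadius_pos hα hβ p₀)
  -- For `p` in this neighbourhood the shadow of `p` contains the fixed ball `B(p₀.1, r)`, on which
  -- the area function is therefore at least `G p`.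
  refine ⟨{p | dist p₀.1 p.1 + r < coneRadius α β p}, ?_, (gauss n (Metric.ball p₀.1 r))⁻¹,
    ENNReal.inv_ne_top.2 (gauss_ball_pos _ hr).ne', fun G p hp => ?_⟩
  · refine (isOpen_lt (((continuous_const.dist continuous_fst)).add continuous_const)
      (continuous_coneRadius α β)).mem_nhds ?_
    change dist p₀.1 p₀.1 + r < coneRadius α β p₀
    rw [dist_self, zero_add]
    exact half_lt_self (coneRadius_pos hα hβ p₀)
  · rw [mul_comm, ← div_eq_mul_inv, ENNReal.le_div_iff_mul_le
      (Or.inl (gauss_ball_pos _ hr).ne') (Or.inl (gauss_ball_lt_top _ _).ne), ← setLIntegral_const]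
    refine (setLIntegral_mono_ae' measurableSet_ball (ae_of_all _ fun x hx => ?_)).trans
      (setLIntegral_le_lintegral (Metric.ball p₀.1 r) _)
    rw [area_top]
    refine le_iSup₂_of_le p (mem_cone_iff.2 ?_) le_rfl
    have := dist_triangle x p₀.1 p.1
    rw [Metric.mem_ball] at hx ⊢
    exact this.trans_lt (lt_of_le_of_lt (by linarith) hp)

lemma exists_memTent_isSumOf (hα : 0 < α) (hβ : 0 < β) (hq : 1 ≤ q) {lam : ℕ → ℝ}
    {a : ℕ → HalfSpace n → ℝ} (hlam : Summable fun m => |lam m|)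
    (hm : ∀ m, AEMeasurable (a m) (halfMeasure n))
    (hc : q = ⊤ → ∀ m, Continuous (a m))
    (ha : ∀ m, tentNorm α β q (a m) ≤ 1) :
    ∃ f : HalfSpace n → ℝ, MemTent α β q f ∧ IsSumOf α β q lam a f ∧
      (tentNorm α β q f).toReal ≤ ∑' m, |lam m| := by
  have hfin : ∑' m, ‖lam m‖ₑ ≠ ⊤ := by rw [tsum_enorm_eq_ofReal hlam]; exact ENNReal.ofReal_ne_top
  -- A local Weierstrass M-test, giving both convergence at every point and continuity of the sum.
  have hloc : q = ⊤ → ∀ p₀, ∃ U ∈ 𝓝 p₀, ∃ u : ℕ → ℝ, Summable u ∧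
      ∀ m, ∀ p ∈ U, ‖lam m * a m p‖ ≤ u m := by
    rintro rfl p₀
    obtain ⟨U, hU, M, hM, h⟩ := exists_nhds_mul_le_lintegral_area (n := n) hα hβ p₀
    refine ⟨U, hU, fun m => |lam m| * M.toReal, hlam.mul_right _, fun m p hp => ?_⟩
    rw [norm_mul, Real.norm_eq_abs]
    refine mul_le_mul_of_nonneg_left ?_ (abs_nonneg _)
    rw [← toReal_enorm]
    exact ENNReal.toReal_mono hM ((h _ p hp).trans (mul_le_of_le_one_right' (ha m)))
  have htop : q = ⊤ → ∀ p, HasSum (fun m => lam m * a m p) (∑' m, lam m * a m p) := by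
    intro h p
    obtain ⟨U, hU, u, hu, hle⟩ := hloc h p
    exact (Summable.of_norm_bounded hu fun m => hle m p (mem_of_mem_nhds hU)).hasSum
  have hae : ∀ᵐ p ∂(halfMeasure n), HasSum (fun m => lam m * a m p) (∑' m, lam m * a m p) := by
    by_cases h : q = ⊤
    · exact ae_of_all _ (htop h)
    · filter_upwards [ae_lt_top_of_lintegral_area hα hβ hq h
        (AEMeasurable.tsum fun m => ((hm m).const_mul (lam m)).enorm)
        ((lintegral_area_tsum_le hq hm ha).trans_lt hfin.lt_top).ne] with p hp
      exact (Summable.of_enorm hp.ne).hasSum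
  have hnorm := tentNorm_le_of_hasSum hq hm ha hae htop
  refine ⟨fun p => ∑' m, lam m * a m p, ⟨?_, fun h => ?_, hnorm.trans_lt hfin.lt_top⟩,
    isSumOf_of_hasSum hq hlam hm ha hae htop, ?_⟩
  · exact aemeasurable_of_tendsto_metrizable_ae atTop
      (fun N => Finset.aemeasurable_fun_sum (Finset.range N) fun m _ => (hm m).const_mul (lam m))
      (hae.mono fun p hp => hp.tendsto_sum_nat)
  · refine continuous_iff_continuousAt.2 fun p => ?_
    obtain ⟨U, hU, u, hu, hle⟩ := hloc h p
    exact (continuousOn_tsum (fun m => (continuous_const.mul (hc h m)).continuousOn) hu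
      hle).continuousAt hU
  · rw [tsum_enorm_eq_ofReal hlam] at hnorm
    exact ENNReal.toReal_le_of_le_ofReal (tsum_nonneg fun m => abs_nonneg _) hnorm

/-! ### Coverings -/

/-- Vitali's lemma with enlargement factor 5; the factor 6 leaves room to pass from closed back to
open balls. Countability holds because disjoint nonempty open sets in a separable space are
countable. -/
lemma exists_countable_disjoint_cover {ι : Type*} (t : Set ι) (x : ι → E n) (r : ι → ℝ) {R : ℝ}
    (h0 : ∀ a ∈ t, 0 < r a) (hR : ∀ a ∈ t, r a ≤ R) :
    ∃ u ⊆ t, u.Countable ∧ u.PairwiseDisjoint (fun a => Metric.ball (x a) (r a)) ∧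
      ∀ a ∈ t, ∃ b ∈ u, Metric.ball (x a) (r a) ⊆ Metric.ball (x b) (6 * r b) := by
  obtain ⟨u, hut, hd, hc⟩ :=
    Vitali.exists_disjoint_subfamily_covering_enlargement_closedBall t x r R hR 5 (by norm_num)
  have hd' : u.PairwiseDisjoint (fun a => Metric.ball (x a) (r a)) :=
    hd.mono fun a => Metric.ball_subset_closedBall
  refine ⟨u, hut, hd'.countable_of_isOpen (fun a _ => Metric.isOpen_ball)
    fun a ha => Metric.nonempty_ball.2 (h0 a (hut ha)), hd', fun a ha => ?_⟩
  obtain ⟨b, hb, hab⟩ := hc a ha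
  refine ⟨b, hb, Metric.ball_subset_closedBall.trans (hab.trans ?_)⟩
  exact Metric.closedBall_subset_ball (by linarith [h0 b (hut hb)])

/-- The size of a Whitney ball: an admissible radius comparable to the distance to the complement
whenever it is not comparable to the cutoff function. -/
lemma exists_whitney_radius {O : Set (E n)} (hO : IsOpen O) {c : E n} (hc : c ∈ O) :
    ∃ w : ℝ, 0 < w ∧ w ≤ cutoff c ∧ Metric.ball c w ⊆ O ∧
      (w = cutoff c ∨ ∃ z ∉ O, dist c z ≤ 2 * w) := by
  by_cases h : Metric.ball c (cutoff c) ⊆ O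
  · exact ⟨cutoff c, cutoff_pos c, le_rfl, h, Or.inl rfl⟩
  · obtain ⟨y, hy, hyO⟩ := Set.not_subset.1 h
    have hne : (Oᶜ).Nonempty := ⟨y, hyO⟩
    have hpos : 0 < Metric.infDist c Oᶜ :=
      (hO.isClosed_compl.notMem_iff_infDist_pos hne).1 fun h' => h' hc
    refine ⟨Metric.infDist c Oᶜ, hpos, ?_, ?_, Or.inr ?_⟩
    · rw [Metric.mem_ball'] at hy
      exact (Metric.infDist_le_dist_of_mem hyO).trans hy.le
    · exact Set.disjoint_compl_right_iff_subset.1 Metric.disjoint_ball_infDist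
    · obtain ⟨z, hz, hlt⟩ := (Metric.infDist_lt_iff hne).1
        (show Metric.infDist c Oᶜ < 2 * Metric.infDist c Oᶜ by linarith)
      exact ⟨z, hz, hlt.le⟩

/-- If `w = m(c)`, slow variation of `m` bounds the radius by `2βw`. Otherwise `z` lies outside the
shadow, so the radius is at most `|y - z| ≤ 3w`. -/
lemma coneRadius_le_of_mem_tent (hβ : 0 < β) {O : Set (E n)} {c : E n} {w : ℝ}
    (hw : w ≤ cutoff c) (h : w = cutoff c ∨ ∃ z ∉ O, dist c z ≤ 2 * w) {p : HalfSpace n}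
    (hp : p ∈ tent α β O) (hpc : dist p.1 c < w) : coneRadius α β p ≤ (3 + 2 * β) * w := by
  have hw0 : 0 < w := dist_nonneg.trans_lt hpc
  rcases h with rfl | ⟨z, hz, hcz⟩
  · have := cutoff_le_two_mul (x := p.1) (y := c)
      (by rw [← dist_eq_norm]; exact hpc.le.trans (hw.trans (cutoff_le_one c)))
    have h2 := coneRadius_le α β p
    nlinarith
  · have hzp : z ∉ shadow α β p := fun h' => hz (mem_tent_iff.1 hp h')
    rw [Metric.mem_ball', not_lt] at hzp
    have := dist_triangle p.1 c z
    nlinarith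

/-- A Whitney covering of an open set by countably many admissible balls (a vanishing radius
means that the index is not used). -/
lemma exists_whitney_cover (n : ℕ) (hβ : 0 < β) :
    ∃ K : ℝ≥0∞, K ≠ ⊤ ∧ ∀ (α : ℝ) (O : Set (E n)), IsOpen O →
      ∃ (c : ℕ → E n) (w : ℕ → ℝ), (∀ j, 0 ≤ w j) ∧ (∀ j, w j ≤ cutoff (c j)) ∧
        (∀ y ∈ O, ∃ j, dist y (c j) < w j / 2) ∧
        (∀ p ∈ tent α β O, ∀ j, dist p.1 (c j) < w j → coneRadius α β p ≤ (3 + 2 * β) * w j) ∧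
        ∑' j, gauss n (Metric.ball (c j) ((4 + 2 * β) * w j)) ≤ K * gauss n O := by
  -- The ratio between the final radius `(4 + 2β)w` and the radius `w/12` of the disjoint balls.
  set A := 12 * (4 + 2 * β) with hA
  refine ⟨ENNReal.ofReal (Real.exp (2 * (A * (2 + A))) * A ^ n), ENNReal.ofReal_ne_top,
    fun α O hO => ?_⟩
  have hex : ∀ c : E n, ∃ w : ℝ, c ∈ O → 0 < w ∧ w ≤ cutoff c ∧ Metric.ball c w ⊆ O ∧
      (w = cutoff c ∨ ∃ z ∉ O, dist c z ≤ 2 * w) := fun c => by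
    by_cases hc : c ∈ O
    · obtain ⟨w, hw⟩ := exists_whitney_radius hO hc
      exact ⟨w, fun _ => hw⟩
    · exact ⟨0, fun h => absurd h hc⟩
  choose v hv using hex
  -- With radii `v/12`, the sixfold enlargements are the half balls `B(c, v/2)`, where the bumps
  -- will equal one.
  obtain ⟨u, huO, hcount, hdisj, hcov⟩ := exists_countable_disjoint_cover O id (fun c => v c / 12)
    (R := 1) (fun c hc => by linarith [(hv c hc).1])
    (fun c hc => by linarith [(hv c hc).1, (hv c hc).2.1, cutoff_le_one c])
  have : Countable u := hcount.to_subtype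
  obtain ⟨e, he⟩ := exists_injective_nat u
  have hcases : ∀ j, (∃ a : u, e a = j) ∨
      (Function.extend e (fun a => (a : E n)) 0 j = 0 ∧
        Function.extend e (fun a => v a) 0 j = 0) := fun j => by
    by_cases h : ∃ a : u, e a = j
    · exact Or.inl h
    · exact Or.inr ⟨Function.extend_apply' _ _ _ h, Function.extend_apply' _ _ _ h⟩
  refine ⟨Function.extend e (fun a => (a : E n)) 0, Function.extend e (fun a => v a) 0,
    fun j => ?_, fun j => ?_, fun y hy => ?_, fun p hp j hj => ?_, ?_⟩
  · rcases hcases j with ⟨a, rfl⟩ | ⟨h1, h2⟩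
    · rw [he.extend_apply]; exact (hv a (huO a.2)).1.le
    · rw [h2]
  · rcases hcases j with ⟨a, rfl⟩ | ⟨h1, h2⟩
    · rw [he.extend_apply, he.extend_apply]; exact (hv a (huO a.2)).2.1
    · rw [h2]; exact (cutoff_pos _).le
  · obtain ⟨b, hb, hsub⟩ := hcov y hy
    refine ⟨e ⟨b, hb⟩, ?_⟩
    rw [he.extend_apply, he.extend_apply]
    have := hsub (Metric.mem_ball_self (by linarith [(hv y hy).1]))
    rw [Metric.mem_ball] at this
    exact this.trans_le (by linarith)
  · rcases hcases j with ⟨a, rfl⟩ | ⟨h1, h2⟩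
    · rw [he.extend_apply] at hj ⊢
      rw [he.extend_apply] at hj
      have := hv a (huO a.2)
      exact coneRadius_le_of_mem_tent hβ this.2.1 this.2.2.2 hp hj
    · rw [h2] at hj
      exact absurd hj (not_lt.2 dist_nonneg)
  · have hext : (fun j => gauss n (Metric.ball (Function.extend e (fun a => (a : E n)) 0 j)
        ((4 + 2 * β) * Function.extend e (fun a => v a) 0 j))) =
        Function.extend e (fun a : u => gauss n (Metric.ball (a : E n) ((4 + 2 * β) * v a))) 0 := by
      ext j
      rcases hcases j with ⟨a, rfl⟩ | ⟨h1, h2⟩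
      · simp only [he.extend_apply]
      · by_cases h : ∃ a : u, e a = j
        · obtain ⟨a, rfl⟩ := h
          simp only [he.extend_apply]
        · rw [Function.extend_apply' _ _ _ h, h2, Function.extend_apply' _ _ _ h]
          simp
    rw [hext, tsum_extend_zero he]
    calc ∑' a : u, gauss n (Metric.ball (a : E n) ((4 + 2 * β) * v a))
        ≤ ∑' a : u, ENNReal.ofReal (Real.exp (2 * (A * (2 + A))) * A ^ n) *
            gauss n (Metric.ball (a : E n) (v a / 12)) := by
          refine ENNReal.tsum_le_tsum fun a => ?_
          have h := hv a (huO a.2)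
          have h1 : 1 ≤ A := by linarith
          refine gauss_ball_le_mul h1 ?_ ?_ (by rw [hA]; linarith)
          · nlinarith [h.1, h.2.1]
          · rw [hA]; nlinarith [h.1, h.2.1]
      _ = _ * gauss n (⋃ a ∈ u, Metric.ball a (v a / 12)) := by
          have h := measure_biUnion (μ := gauss n) hcount hdisj fun a _ => measurableSet_ball
          simp only [id_eq] at h
          rw [ENNReal.tsum_mul_left, h]
      _ ≤ _ := by
          gcongr
          refine Set.iUnion₂_subset fun a ha => ?_
          have h := hv a (huO ha)
          exact (Metric.ball_subset_ball (by linarith [h.1])).trans h.2.2.1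

/-! ### Points of density -/

/-- The union of all shadows of which `O` occupies more than half. -/
def densityHull (α β : ℝ) (O : Set (E n)) : Set (E n) :=
  ⋃ p ∈ {p : HalfSpace n | gauss n (shadow α β p) < 2 * gauss n (shadow α β p ∩ O)}, shadow α β p

lemma isOpen_densityHull (O : Set (E n)) : IsOpen (densityHull α β O) :=
  isOpen_biUnion fun _ _ => Metric.isOpen_ball

lemma densityHull_mono {O O' : Set (E n)} (h : O ⊆ O') :
    densityHull α β O ⊆ densityHull α β O' := by
  refine Set.biUnion_subset_biUnion_left fun p hp => ?_
  have hp' : gauss n (shadow α β p) < 2 * gauss n (shadow α β p ∩ O) := hp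
  refine lt_of_lt_of_le hp' ?_
  gcongr

/-- A shadow more than half filled by `O` is contained in the hull by construction. -/
lemma gauss_shadow_le_of_notMem_tent {O : Set (E n)} (hO : MeasurableSet O) {p : HalfSpace n}
    (hp : p ∉ tent α β (densityHull α β O)) :
    gauss n (shadow α β p) ≤ 2 * gauss n (shadow α β p ∩ Oᶜ) := by
  have h : ¬ gauss n (shadow α β p) < 2 * gauss n (shadow α β p ∩ O) := fun h =>
    hp (mem_tent_iff.2 (Set.subset_biUnion_of_mem (u := fun p => shadow α β p) h))
  have hsum := measure_inter_add_sdiff (μ := gauss n) (shadow α β p) hO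
  rw [Set.sdiff_eq] at hsum
  have hfin := gauss_shadow_ne_top (α := α) (β := β) p
  have hx : gauss n (shadow α β p ∩ O) ≠ ⊤ := measure_ne_top_of_subset Set.inter_subset_left hfin
  have hy : gauss n (shadow α β p ∩ Oᶜ) ≠ ⊤ := measure_ne_top_of_subset Set.inter_subset_left hfin
  rw [← hsum] at h ⊢
  rw [not_lt, two_mul] at h
  rw [two_mul]
  exact add_le_add_left ((ENNReal.add_le_add_iff_left hx).1 h) _

/-- A weak-type maximal estimate: disjoint Vitali shadows, enlarged six times, cover the hull;
doubling removes the enlargement, and each shadow has measure at most twice that of its part in `O`.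
-/
lemma exists_gauss_densityHull_le (n : ℕ) (hα : 0 < α) (hβ : 0 < β) :
    ∃ K : ℝ≥0∞, K ≠ ⊤ ∧ ∀ O : Set (E n), MeasurableSet O →
      gauss n (densityHull α β O) ≤ K * gauss n O := by
  -- Large enough for the enlargement factor 6 and for radii up to `6β m`.
  set A := 6 * (1 + β) with hA
  set K := ENNReal.ofReal (Real.exp (2 * (A * (2 + A))) * A ^ n)
  refine ⟨K * 2, ENNReal.mul_ne_top ENNReal.ofReal_ne_top ENNReal.ofNat_ne_top, fun O hO => ?_⟩
  set t := {p : HalfSpace n | gauss n (shadow α β p) < 2 * gauss n (shadow α β p ∩ O)} with ht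
  obtain ⟨u, hut, hcount, hdisj, hcov⟩ := exists_countable_disjoint_cover t
    (fun p : HalfSpace n => p.1) (coneRadius α β) (R := β) (fun p _ => coneRadius_pos hα hβ p)
    (fun p _ => (coneRadius_le α β p).trans (mul_le_of_le_one_right hβ.le (cutoff_le_one _)))
  have hsub : densityHull α β O ⊆ ⋃ p ∈ u, Metric.ball p.1 (6 * coneRadius α β p) := by
    refine Set.iUnion₂_subset fun p hp => ?_
    obtain ⟨b, hb, h⟩ := hcov p hp
    exact h.trans (Set.subset_biUnion_of_mem
      (u := fun p : HalfSpace n => Metric.ball p.1 (6 * coneRadius α β p)) hb)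
  calc gauss n (densityHull α β O)
      ≤ ∑' p : u, gauss n (Metric.ball (p : HalfSpace n).1 (6 * coneRadius α β (p : HalfSpace n))) :=
        (measure_mono hsub).trans (measure_biUnion_le _ hcount _)
    _ ≤ ∑' p : u, K * 2 * gauss n (shadow α β (p : HalfSpace n) ∩ O) := by
        refine ENNReal.tsum_le_tsum fun p => ?_
        have h0 := coneRadius_pos hα hβ (p : HalfSpace n)
        have h1 := coneRadius_le α β (p : HalfSpace n)
        have h2 := cutoff_pos (p : HalfSpace n).1
        rw [mul_assoc]
        refine (gauss_ball_le_mul (A := A) (by linarith) ?_ ?_ ?_).trans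
          (mul_le_mul_right (le_of_lt (hut p.2)) K)
        · nlinarith
        · nlinarith
        · rw [hA]; nlinarith
    _ = K * 2 * gauss n (⋃ p ∈ u, shadow α β p ∩ O) := by
        rw [ENNReal.tsum_mul_left, measure_biUnion hcount
          (hdisj.mono fun p => Set.inter_subset_left) fun p _ => measurableSet_ball.inter hO]
    _ ≤ K * 2 * gauss n O := by
        gcongr
        exact Set.iUnion₂_subset fun p _ => Set.inter_subset_right

/-! ### Partitions of unity -/

/-- A continuous bump equal to `1` on `B(c, w/2)` and vanishing off `B(c, w)`. -/
noncomputable def bump (c : E n) (w : ℝ) (y : E n) : ℝ :=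
  min 1 (2 * max 0 (w - dist y c) / w)

lemma continuous_bump (c : E n) (w : ℝ) : Continuous (bump c w) := by
  unfold bump; fun_prop

lemma bump_le_one (c : E n) (w : ℝ) (y : E n) : bump c w y ≤ 1 := min_le_left _ _

lemma bump_nonneg {w : ℝ} (hw : 0 ≤ w) (c y : E n) : 0 ≤ bump c w y :=
  le_min zero_le_one (by positivity)

lemma bump_eq_one {c y : E n} {w : ℝ} (h : dist y c < w / 2) : bump c w y = 1 := by
  have hd : 0 ≤ dist y c := dist_nonneg
  refine min_eq_left ?_
  rw [le_div_iff₀ (by linarith)]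
  linarith [le_max_right 0 (w - dist y c)]

lemma bump_eq_zero {c y : E n} {w : ℝ} (h : w ≤ dist y c) : bump c w y = 0 := by
  rw [bump, max_eq_left (by linarith)]
  simp

/-- The product `∏_{i < j} (1 - ψ_i)` of the complements of bumps. -/
noncomputable def bumpTail (c : ℕ → E n) (w : ℕ → ℝ) (j : ℕ) (y : E n) : ℝ :=
  ∏ i ∈ Finset.range j, (1 - bump (c i) (w i) y)

/-- The partition functions `ψ_j ∏_{i < j} (1 - ψ_i)`. -/
noncomputable def partition (c : ℕ → E n) (w : ℕ → ℝ) (j : ℕ) (y : E n) : ℝ :=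
  bumpTail c w j y * bump (c j) (w j) y

lemma continuous_partition (c : ℕ → E n) (w : ℕ → ℝ) (j : ℕ) :
    Continuous (partition c w j) :=
  (continuous_finsetProd _ fun _ _ => continuous_const.sub (continuous_bump _ _)).mul
    (continuous_bump _ _)

lemma abs_partition_le_one (c : ℕ → E n) {w : ℕ → ℝ} (hw : ∀ j, 0 ≤ w j) (j : ℕ) (y : E n) :
    |partition c w j y| ≤ 1 := by
  have h0 : 0 ≤ bumpTail c w j y :=
    Finset.prod_nonneg fun i _ => sub_nonneg.2 (bump_le_one _ _ _)
  have h1 : bumpTail c w j y ≤ 1 :=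
    Finset.prod_le_one (fun i _ => sub_nonneg.2 (bump_le_one _ _ _))
      fun i _ => by linarith [bump_nonneg (hw i) (c i) y]
  rw [partition, abs_of_nonneg (mul_nonneg h0 (bump_nonneg (hw j) _ _))]
  exact mul_le_one₀ h1 (bump_nonneg (hw j) _ _) (bump_le_one _ _ _)

lemma partition_eq_zero {c : ℕ → E n} {w : ℕ → ℝ} {j : ℕ} {y : E n} (h : w j ≤ dist y (c j)) :
    partition c w j y = 0 := by
  rw [partition, bump_eq_zero h, mul_zero]

/-- The terms telescope as `bumpTail j - bumpTail (j + 1)`, and the tail vanishes after the first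
bump equal to one. No local finiteness of the cover is needed. -/
lemma hasSum_partition {c : ℕ → E n} {w : ℕ → ℝ} {y : E n} (h : ∃ j, dist y (c j) < w j / 2) :
    HasSum (fun j => partition c w j y) 1 := by
  obtain ⟨j, hj⟩ := h
  have hzero : ∀ i, j < i → bumpTail c w i y = 0 := fun i hi =>
    Finset.prod_eq_zero (Finset.mem_range.2 hi) (by rw [bump_eq_one hj, sub_self])
  have hsum : ∑ i ∈ Finset.range (j + 1), partition c w i y = 1 := by
    have : ∀ i, partition c w i y = bumpTail c w i y - bumpTail c w (i + 1) y := fun i => by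
      rw [bumpTail, bumpTail, Finset.prod_range_succ, partition, bumpTail]
      ring
    simp only [this, Finset.sum_range_sub', hzero (j + 1) (Nat.lt_succ_self j)]
    simp [bumpTail]
  rw [← hsum]
  refine hasSum_sum_of_ne_finset_zero fun i hi => ?_
  rw [partition, hzero i (by simpa using hi), zero_mul]

/-! ### Assembling atoms -/

/-- Fills the indices whose Whitney radius is zero. -/
lemma isAtom_zero {δ : ℝ} (hδ : 0 < δ) : IsAtom α β δ q (fun _ : HalfSpace n => (0 : ℝ)) := by
  refine ⟨aemeasurable_const, fun _ => continuous_const, 0, δ * cutoff (0 : E n),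
    mul_pos hδ (cutoff_pos _), le_rfl, ?_, ?_⟩
  · have : tsupport (fun _ : HalfSpace n => (0 : ℝ)) = ∅ := tsupport_eq_empty_iff.2 rfl
    rw [this]
    exact Set.empty_subset _
  · have : eLpNorm (fun _ : HalfSpace n => (0 : ℝ)) q (halfMeasure n) = 0 := eLpNorm_zero'
    rw [this]
    exact zero_le

/-- On the support of `g χ`, `y` is within `w` of `c` and the shadow radius is at most `(3 + 2β)w`,
so the shadow lies in `B = B(c, (4 + 2β)w)`. Dividing by `b γ(B)` turns the bound `b γ(B)^{1/q}`
into the atomic normalization. -/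
lemma isAtom_of_whitney {δ w lam b : ℝ} {O : Set (E n)} {c : E n} {g : HalfSpace n → ℝ}
    {χ : E n → ℝ} (hβ : 0 < β) (hδ : δ = 4 + 2 * β) (hw : 0 < w) (hwm : w ≤ cutoff c)
    (hg : AEMeasurable g (halfMeasure n)) (hgc : q = ⊤ → Continuous g)
    (hgO : ∀ p, p ∉ tent α β O → g p = 0)
    (hr : ∀ p ∈ tent α β O, dist p.1 c < w → coneRadius α β p ≤ (3 + 2 * β) * w)
    (hχ : Continuous χ) (hχ1 : ∀ y, |χ y| ≤ 1) (hχ0 : ∀ y, w ≤ dist y c → χ y = 0)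
    (hb : 0 < b)
    (hnorm : eLpNorm ((tent α β (Metric.ball c (δ * w))).indicator g) q (halfMeasure n) ≤
      ENNReal.ofReal b * gauss n (Metric.ball c (δ * w)) ^ (q⁻¹).toReal)
    (hlam : lam = b * (gauss n (Metric.ball c (δ * w))).toReal) :
    IsAtom α β δ q fun p => lam⁻¹ * (g p * χ p.1) := by
  have hδ0 : 0 < δ := by linarith
  have hγ0 := (gauss_ball_pos c (mul_pos hδ0 hw)).ne'
  have hγt := (gauss_ball_lt_top c (δ * w)).ne
  have hlam0 : 0 < lam := hlam ▸ mul_pos hb (ENNReal.toReal_pos hγ0 hγt)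
  have hmem : ∀ p, g p * χ p.1 ≠ 0 → p ∈ tent α β (Metric.ball c (δ * w)) := fun p hp => by
    have hpO : p ∈ tent α β O := by
      by_contra h
      exact hp (by rw [hgO p h, zero_mul])
    have hpc : dist p.1 c < w := by
      by_contra h
      exact hp (by rw [hχ0 _ (not_lt.1 h), mul_zero])
    have hrad : coneRadius α β p ≤ (3 + 2 * β) * w := hr p hpO hpc
    rw [mem_tent_iff]
    exact Metric.ball_subset_ball' (by rw [hδ]; linarith)
  refine ⟨(hg.mul (hχ.measurable.comp measurable_fst).aemeasurable).const_mul _,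
    fun h => continuous_const.mul ((hgc h).mul (hχ.comp continuous_fst)), c, δ * w,
    mul_pos hδ0 hw, mul_le_mul_of_nonneg_left hwm hδ0.le, ?_, ?_⟩
  · refine closure_minimal (fun p hp => hmem p fun h => hp ?_) (isClosed_tent _ _ _)
    change lam⁻¹ * (g p * χ p.1) = 0
    rw [h, mul_zero]
  · have hle : ∀ p, ‖lam⁻¹ * (g p * χ p.1)‖ ≤
        ‖(lam⁻¹ • (tent α β (Metric.ball c (δ * w))).indicator g) p‖ := fun p => by
      rw [Pi.smul_apply, smul_eq_mul, norm_mul, norm_mul lam⁻¹]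
      refine mul_le_mul_of_nonneg_left ?_ (norm_nonneg lam⁻¹)
      by_cases hp : g p * χ p.1 = 0
      · simp [hp]
      · rw [Set.indicator_of_mem (hmem p hp), norm_mul]
        exact mul_le_of_le_one_right (norm_nonneg _) (hχ1 _)
    refine (eLpNorm_mono hle).trans ?_
    rw [eLpNorm_const_smul]
    refine (mul_le_mul_right hnorm _).trans (le_of_eq ?_)
    have hlamE : ‖lam⁻¹‖ₑ = (ENNReal.ofReal b)⁻¹ * (gauss n (Metric.ball c (δ * w)))⁻¹ := by
      rw [Real.enorm_of_nonneg (inv_nonneg.2 hlam0.le), ENNReal.ofReal_inv_of_pos hlam0, hlam,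
        ENNReal.ofReal_mul hb.le, ENNReal.ofReal_toReal hγt,
        ENNReal.mul_inv (Or.inr hγt) (Or.inr hγ0)]
    have hb0 : ENNReal.ofReal b ≠ 0 := (ENNReal.ofReal_pos.2 hb).ne'
    rw [hlamE, neg_sub, sub_eq_add_neg, ENNReal.rpow_add _ _ hγ0 hγt, ENNReal.rpow_neg_one,
      mul_mul_mul_comm, ENNReal.inv_mul_cancel hb0 ENNReal.ofReal_ne_top, one_mul, mul_comm]

/-- Functions carried by the tents over open sets are decomposed into atoms, provided that they
satisfy an `L^q` bound on the tents over balls. -/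
lemma exists_atoms_of_tents (n : ℕ) (hα : 0 < α) (hβ : 0 < β) :
    ∃ δ : ℝ, 0 < δ ∧ ∃ K : ℝ≥0∞, K ≠ ⊤ ∧ ∀ (q : ℝ≥0∞) (O : ℤ → Set (E n))
      (g : ℤ → HalfSpace n → ℝ) (b : ℤ → ℝ), (∀ k, IsOpen (O k)) → (∀ k, 0 < b k) →
      (∀ k, AEMeasurable (g k) (halfMeasure n)) → (∀ k, q = ⊤ → Continuous (g k)) →
      (∀ k, ∀ p, p ∉ tent α β (O k) → g k p = 0) →
      (∀ k c r, eLpNorm ((tent α β (Metric.ball c r)).indicator (g k)) q (halfMeasure n) ≤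
        ENNReal.ofReal (b k) * gauss n (Metric.ball c r) ^ (q⁻¹).toReal) →
      ∃ (lam : ℕ → ℝ) (a : ℕ → HalfSpace n → ℝ), (∀ m, IsAtom α β δ q (a m)) ∧
        ∑' m, ‖lam m‖ₑ ≤ K * ∑' k, ENNReal.ofReal (b k) * gauss n (O k) ∧
        ∀ p s, HasSum (fun m => lam m * a m p) s → HasSum (fun k => g k p) s := by
  obtain ⟨K, hK, hcover⟩ := exists_whitney_cover n hβ
  refine ⟨4 + 2 * β, by linarith, K, hK, fun q O g b hO hb hgm hgc hgO hg => ?_⟩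
  choose c w hw hwm hcov hrad hsum using fun k => hcover α (O k) (hO k)
  set δ := 4 + 2 * β with hδ
  have hδ0 : 0 < δ := by linarith
  set lam : ℤ × ℕ → ℝ := fun z =>
    b z.1 * (gauss n (Metric.ball (c z.1 z.2) (δ * w z.1 z.2))).toReal with hlam
  set a : ℤ × ℕ → HalfSpace n → ℝ := fun z p =>
    (lam z)⁻¹ * (g z.1 p * partition (c z.1) (w z.1) z.2 p.1) with ha
  have hzero : ∀ z : ℤ × ℕ, w z.1 z.2 = 0 → ∀ y, partition (c z.1) (w z.1) z.2 y = 0 :=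
    fun z hz y => partition_eq_zero (hz ▸ dist_nonneg)
  have hatom : ∀ z, IsAtom α β δ q (a z) := fun z => by
    rcases (hw z.1 z.2).eq_or_lt with h | h
    · have : a z = fun _ => 0 := by
        ext p
        rw [ha]
        simp only [hzero z h.symm, mul_zero]
      rw [this]
      exact isAtom_zero hδ0
    · exact isAtom_of_whitney hβ hδ h (hwm _ _) (hgm _) (hgc _) (hgO _)
        (fun p hp => hrad z.1 p hp z.2) (continuous_partition _ _ _)
        (abs_partition_le_one _ (hw _) _) (fun y hy => partition_eq_zero hy) (hb _) (hg _ _ _) rfl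
  have hmul : ∀ z p, lam z * a z p = g z.1 p * partition (c z.1) (w z.1) z.2 p.1 := fun z p => by
    rcases (hw z.1 z.2).eq_or_lt with h | h
    · rw [ha]
      simp only [hzero z h.symm, mul_zero]
    · have : lam z ≠ 0 := (mul_pos (hb _) (ENNReal.toReal_pos
        (gauss_ball_pos _ (mul_pos hδ0 h)).ne' (gauss_ball_lt_top _ _).ne)).ne'
      exact mul_inv_cancel_left₀ this _
  have e : ℕ ≃ ℤ × ℕ := (Denumerable.eqv (ℤ × ℕ)).symm
  refine ⟨lam ∘ e, a ∘ e, fun m => hatom _, ?_, fun p s hs => ?_⟩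
  · calc ∑' m, ‖(lam ∘ e) m‖ₑ = ∑' z, ‖lam z‖ₑ := e.tsum_eq fun z => ‖lam z‖ₑ
      _ = ∑' k, ∑' j, ‖lam (k, j)‖ₑ := ENNReal.tsum_prod' (f := fun z => ‖lam z‖ₑ)
      _ = ∑' k, ENNReal.ofReal (b k) * ∑' j, gauss n (Metric.ball (c k j) (δ * w k j)) := by
          refine tsum_congr fun k => ?_
          rw [← ENNReal.tsum_mul_left]
          refine tsum_congr fun j => ?_
          rw [hlam, Real.enorm_of_nonneg (mul_nonneg (hb k).le ENNReal.toReal_nonneg),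
            ENNReal.ofReal_mul (hb k).le, ENNReal.ofReal_toReal (gauss_ball_lt_top _ _).ne]
      _ ≤ ∑' k, ENNReal.ofReal (b k) * (K * gauss n (O k)) := by
          gcongr with k
          exact hsum k
      _ = K * ∑' k, ENNReal.ofReal (b k) * gauss n (O k) := by
          rw [← ENNReal.tsum_mul_left]
          exact tsum_congr fun k => mul_left_comm _ _ _
  · have hs' : HasSum (fun z => lam z * a z p) s :=
      (e.hasSum_iff (f := fun z => lam z * a z p)).1 hs
    simp only [hmul] at hs'
    -- An unconditional sum over pairs may be summed in `j` first; for fixed `k` the partition of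
    -- unity returns `g k p`.
    refine hs'.prod_fiberwise fun k => ?_
    by_cases hp : p ∈ tent α β (O k)
    · simpa using (hasSum_partition (hcov k p.1
        (mem_tent_iff.1 hp (Metric.mem_ball_self (coneRadius_pos hα hβ p))))).mul_left (g k p)
    · simp only [hgO k p hp, zero_mul]
      exact hasSum_zero

/-! ### Dyadic level sets -/

/-- Each `2^k` is twice the length of `(2^{k-1}, 2^k]`; these intervals are disjoint and, when `2^k
< s`, lie in `(0, s]`. -/
lemma tsum_dyadic_le (s : ℝ≥0∞) :
    ∑' k : ℤ, {t | ENNReal.ofReal ((2 : ℝ) ^ k) < t}.indicator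
      (fun _ => ENNReal.ofReal ((2 : ℝ) ^ k)) s ≤ 2 * s := by
  by_cases hs : s = ⊤
  · simp [hs]
  have hmono : Monotone fun k : ℤ => (2 : ℝ) ^ k := zpow_right_mono₀ one_le_two
  have hsucc : ∀ k : ℤ, (2 : ℝ) ^ k = 2 * 2 ^ (Order.pred k) := fun k => by
    rw [← zpow_one_add₀ two_ne_zero, show Order.pred k = k - 1 from rfl, add_sub_cancel]
  set I : ℤ → Set ℝ := fun k =>
    {x | x ∈ Set.Ioc ((2 : ℝ) ^ (Order.pred k)) (2 ^ k) ∧ ENNReal.ofReal ((2 : ℝ) ^ k) < s} with hI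
  have hIsub : ∀ k, I k ⊆ Set.Ioc ((2 : ℝ) ^ (Order.pred k)) (2 ^ k) := fun k x hx => hx.1
  have hcases : ∀ k, (ENNReal.ofReal ((2 : ℝ) ^ k) < s ∧
      I k = Set.Ioc ((2 : ℝ) ^ (Order.pred k)) (2 ^ k)) ∨
        (¬ ENNReal.ofReal ((2 : ℝ) ^ k) < s ∧ I k = ∅) := fun k => by
    by_cases h : ENNReal.ofReal ((2 : ℝ) ^ k) < s
    · exact Or.inl ⟨h, by ext x; simp [hI, h]⟩
    · exact Or.inr ⟨h, by ext x; simp [hI, h]⟩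
  have hmeas : ∀ k, MeasurableSet (I k) := fun k => by
    rcases hcases k with ⟨-, h⟩ | ⟨-, h⟩ <;> rw [h]
    · exact measurableSet_Ioc
    · exact MeasurableSet.empty
  calc ∑' k : ℤ, {t | ENNReal.ofReal ((2 : ℝ) ^ k) < t}.indicator
        (fun _ => ENNReal.ofReal ((2 : ℝ) ^ k)) s
      = ∑' k : ℤ, 2 * volume (I k) := by
        refine tsum_congr fun k => ?_
        rcases hcases k with ⟨h, h'⟩ | ⟨h, h'⟩
        · rw [Set.indicator_of_mem (by exact h), h', Real.volume_Ioc, hsucc k, two_mul,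
            add_sub_cancel_right, ENNReal.ofReal_add (by positivity) (by positivity), two_mul]
        · rw [Set.indicator_of_notMem (by exact h), h', measure_empty, mul_zero]
    _ = 2 * volume (⋃ k, I k) := by
        rw [ENNReal.tsum_mul_left, measure_iUnion _ hmeas]
        exact fun i j hij => (hmono.pairwise_disjoint_on_Ioc_pred hij).mono (hIsub i) (hIsub j)
    _ ≤ 2 * volume (Set.Ioc 0 s.toReal) := by
        gcongr
        refine Set.iUnion_subset fun k x hx => ⟨lt_trans (by positivity) hx.1.1, ?_⟩
        exact hx.1.2.trans ((ENNReal.ofReal_le_iff_le_toReal hs).1 hx.2.le)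
    _ = 2 * s := by rw [Real.volume_Ioc, sub_zero, ENNReal.ofReal_toReal hs]

lemma tsum_mul_measure_dyadic_le {X : Type*} [MeasurableSpace X] (μ : Measure X) {S : X → ℝ≥0∞}
    (hS : Measurable S) :
    ∑' k : ℤ, ENNReal.ofReal ((2 : ℝ) ^ (k + 2)) * μ {x | ENNReal.ofReal ((2 : ℝ) ^ k) < S x} ≤
      8 * ∫⁻ x, S x ∂μ := by
  have hk : ∀ k : ℤ, MeasurableSet {t | ENNReal.ofReal ((2 : ℝ) ^ k) < t} :=
    fun k => measurableSet_Ioi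
  calc ∑' k : ℤ, ENNReal.ofReal ((2 : ℝ) ^ (k + 2)) * μ {x | ENNReal.ofReal ((2 : ℝ) ^ k) < S x}
      = 4 * ∑' k : ℤ, ∫⁻ x, {t | ENNReal.ofReal ((2 : ℝ) ^ k) < t}.indicator
          (fun _ => ENNReal.ofReal ((2 : ℝ) ^ k)) (S x) ∂μ := by
        rw [← ENNReal.tsum_mul_left]
        refine tsum_congr fun k => ?_
        have : (fun x => {t | ENNReal.ofReal ((2 : ℝ) ^ k) < t}.indicator
            (fun _ => ENNReal.ofReal ((2 : ℝ) ^ k)) (S x)) =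
            {x | ENNReal.ofReal ((2 : ℝ) ^ k) < S x}.indicator
              fun _ => ENNReal.ofReal ((2 : ℝ) ^ k) := rfl
        have hSk : MeasurableSet {x | ENNReal.ofReal ((2 : ℝ) ^ k) < S x} := hS (hk k)
        rw [this, lintegral_indicator hSk, setLIntegral_const, zpow_add₀ two_ne_zero,
          ENNReal.ofReal_mul (by positivity), ← mul_assoc, mul_comm (4 : ℝ≥0∞)]
        norm_num
    _ = 4 * ∫⁻ x, ∑' k : ℤ, {t | ENNReal.ofReal ((2 : ℝ) ^ k) < t}.indicator
          (fun _ => ENNReal.ofReal ((2 : ℝ) ^ k)) (S x) ∂μ := by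
        rw [lintegral_tsum]
        exact fun k => ((measurable_const.indicator (hk k)).comp hS).aemeasurable
    _ ≤ 4 * ∫⁻ x, 2 * S x ∂μ := by
        gcongr with x
        exact tsum_dyadic_le (S x)
    _ = 8 * ∫⁻ x, S x ∂μ := by
        rw [lintegral_const_mul' _ _ ENNReal.ofNat_ne_top, ← mul_assoc]
        norm_num

/-- A decomposition of `f` into layers carried by tents over open sets, at dyadic heights. -/
structure IsTentLayering (α β : ℝ) (q : ℝ≥0∞) (f : HalfSpace n → ℝ) (O : ℤ → Set (E n))
    (g : ℤ → HalfSpace n → ℝ) : Prop where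
  isOpen : ∀ k, IsOpen (O k)
  aemeasurable : ∀ k, AEMeasurable (g k) (halfMeasure n)
  continuous_of_top : ∀ k, q = ⊤ → Continuous (g k)
  eq_zero : ∀ k, ∀ p, p ∉ tent α β (O k) → g k p = 0
  eLpNorm_le : ∀ k c r,
    eLpNorm ((tent α β (Metric.ball c r)).indicator (g k)) q (halfMeasure n) ≤
      ENNReal.ofReal ((2 : ℝ) ^ (k + 2)) * gauss n (Metric.ball c r) ^ (q⁻¹).toReal
  tendsto_ae : ∀ᵐ p ∂(halfMeasure n),
    Tendsto (fun N : ℕ => ∑ k ∈ Finset.Ico (-(N : ℤ)) N, g k p) atTop (𝓝 (f p))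
  tendsto_of_top : q = ⊤ → ∀ p,
    Tendsto (fun N : ℕ => ∑ k ∈ Finset.Ico (-(N : ℤ)) N, g k p) atTop (𝓝 (f p))

lemma sum_Ico_int_sub (u : ℤ → ℝ) (N : ℕ) :
    ∑ k ∈ Finset.Ico (-(N : ℤ)) N, (u (k + 1) - u k) = u N - u (-N) := by
  have key : ∀ M : ℕ, ∑ k ∈ Finset.Ico (-(N : ℤ)) (-N + M), (u (k + 1) - u k) =
      u (-N + M) - u (-N) := by
    intro M
    induction M with
    | zero => simp
    | succ M ih =>
      have : Finset.Ico (-(N : ℤ)) (-N + (M + 1 : ℕ)) =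
          insert (-(N : ℤ) + M) (Finset.Ico (-(N : ℤ)) (-N + M)) := by
        ext k
        simp only [Finset.mem_Ico, Finset.mem_insert]
        omega
      rw [this, Finset.sum_insert (by simp), ih]
      push_cast
      rw [add_assoc]
      ring
  have := key (2 * N)
  rwa [show -(N : ℤ) + (2 * N : ℕ) = N by push_cast; ring] at this

/-! ### Layers for `q = ∞` -/

/-- Truncation of `s` to `[-t, t]`. -/
def clamp (t s : ℝ) : ℝ := max (-t) (min s t)

lemma continuous_clamp (t : ℝ) : Continuous (clamp t) := by unfold clamp; fun_prop

lemma clamp_eq_self {t s : ℝ} (h : |s| ≤ t) : clamp t s = s := by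
  rw [clamp, min_eq_left (abs_le.1 h).2, max_eq_right (abs_le.1 h).1]

lemma abs_clamp_le {t : ℝ} (ht : 0 ≤ t) (s : ℝ) : |clamp t s| ≤ t :=
  abs_le.2 ⟨le_max_left _ _, max_le (by linarith) (min_le_right _ _)⟩

/-- If `|f p| > 2^k` then the whole shadow of `p` lies in `{S > 2^k}`. So off the tent over that set
`|f| ≤ 2^k`, and the truncations at `2^k` and `2^{k+1}` agree. -/
lemma exists_tentLayering_top (f : HalfSpace n → ℝ) (hf : MemTent α β ⊤ f) :
    ∃ (O : ℤ → Set (E n)) (g : ℤ → HalfSpace n → ℝ), IsTentLayering α β ⊤ f O g ∧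
      ∑' k : ℤ, ENNReal.ofReal ((2 : ℝ) ^ (k + 2)) * gauss n (O k) ≤ 8 * tentNorm α β ⊤ f := by
  have hc := hf.continuous_of_top rfl
  set S := area α β ⊤ (fun p => ‖f p‖ₑ) with hS
  have hzero : ∀ (k : ℤ) p, p ∉ tent α β {x | ENNReal.ofReal ((2 : ℝ) ^ k) < S x} →
      |f p| ≤ 2 ^ k := fun k p hp => by
    by_contra! h
    refine hp (mem_tent_iff.2 fun x hx => ?_)
    refine lt_of_lt_of_le ?_ (show ‖f p‖ₑ ≤ S x by
      rw [hS, area_top]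
      exact le_iSup₂_of_le p (mem_cone_iff.2 hx) le_rfl)
    rw [Real.enorm_eq_ofReal_abs]
    exact (ENNReal.ofReal_lt_ofReal_iff_of_nonneg (by positivity)).2 h
  have htend : ∀ p, Tendsto (fun N : ℕ => ∑ k ∈ Finset.Ico (-(N : ℤ)) N,
      (clamp (2 ^ (k + 1)) (f p) - clamp (2 ^ k) (f p))) atTop (𝓝 (f p)) := fun p => by
    simp only [fun N => sum_Ico_int_sub (fun k => clamp (2 ^ k) (f p)) N]
    have h1 : Tendsto (fun N : ℕ => clamp (2 ^ (N : ℤ)) (f p)) atTop (𝓝 (f p)) := by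
      refine tendsto_const_nhds.congr' ?_
      filter_upwards [(tendsto_pow_atTop_atTop_of_one_lt (one_lt_two (α := ℝ))).eventually_ge_atTop
        |f p|] with N hN
      rw [clamp_eq_self (by simpa using hN)]
    have h2 : Tendsto (fun N : ℕ => clamp (2 ^ (-N : ℤ)) (f p)) atTop (𝓝 0) := by
      refine squeeze_zero_norm (fun N => abs_clamp_le (by positivity) _) ?_
      have := tendsto_pow_atTop_nhds_zero_of_lt_one (r := (1 / 2 : ℝ)) (by norm_num) (by norm_num)
      refine this.congr fun N => ?_
      simp
    simpa using h1.sub h2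
  refine ⟨fun k => {x | ENNReal.ofReal ((2 : ℝ) ^ k) < S x},
    fun k p => clamp (2 ^ (k + 1)) (f p) - clamp (2 ^ k) (f p),
    ⟨fun k => ?_, fun k => ?_, fun k _ => ?_, fun k p hp => ?_, fun k c r => ?_,
      ae_of_all _ htend, fun _ => htend⟩, ?_⟩
  · have : {x | ENNReal.ofReal ((2 : ℝ) ^ k) < S x} =
        ⋃ p ∈ {p | ENNReal.ofReal ((2 : ℝ) ^ k) < ‖f p‖ₑ}, shadow α β p := by
      ext x
      simp only [hS, area_top, lt_iSup_iff, Set.mem_iUnion, mem_cone_iff, Set.mem_ofPred_eq,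
        exists_prop, and_comm]
    rw [this]
    exact isOpen_biUnion fun p _ => Metric.isOpen_ball
  · exact ((continuous_clamp _).measurable.comp_aemeasurable hf.aemeasurable).sub
      ((continuous_clamp _).measurable.comp_aemeasurable hf.aemeasurable)
  · exact ((continuous_clamp _).comp hc).sub ((continuous_clamp _).comp hc)
  · have h := hzero k p hp
    have h2 : (2 : ℝ) ^ k ≤ 2 ^ (k + 1) := zpow_right_mono₀ one_le_two (by omega)
    simp only [clamp_eq_self h, clamp_eq_self (h.trans h2), sub_self]
  · simp only [ENNReal.inv_top, ENNReal.toReal_zero, ENNReal.rpow_zero, mul_one,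
      eLpNorm_exponent_top]
    refine eLpNormEssSup_le_of_ae_enorm_bound (ae_of_all _ fun p => ?_)
    refine (enorm_indicator_le_enorm_self _ _).trans ?_
    rw [Real.enorm_eq_ofReal_abs]
    refine ENNReal.ofReal_le_ofReal ((abs_sub _ _).trans ?_)
    have h1 := abs_clamp_le (show (0 : ℝ) ≤ 2 ^ (k + 1) by positivity) (f p)
    have h2 := abs_clamp_le (show (0 : ℝ) ≤ 2 ^ k by positivity) (f p)
    have hk : (0 : ℝ) < 2 ^ k := by positivity
    have h4 : (2 : ℝ) ^ (k + 2) = 2 ^ k * 4 := by rw [zpow_add₀ two_ne_zero]; norm_num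
    have h5 : (2 : ℝ) ^ (k + 1) = 2 ^ k * 2 := zpow_add_one₀ two_ne_zero k
    linarith
  · exact tsum_mul_measure_dyadic_le _ (measurable_area hf.aemeasurable.enorm)

/-! ### Layers for `q < ∞` -/

/-- On `T` the fraction of the shadow inside `A` is at least one half, so Tonelli bounds `∫_T |f|^q`
by `2 ∫_A S^q`, and `S ≤ t` on `A`. -/
lemma eLpNorm_indicator_le_of_shadow (hα : 0 < α) (hβ : 0 < β) (hq : 1 ≤ q) (h : q ≠ ⊤)
    {f : HalfSpace n → ℝ} (hf : AEMeasurable f (halfMeasure n)) {T : Set (HalfSpace n)}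
    {A B : Set (E n)} {t : ℝ}
    (hTA : ∀ p ∈ T, gauss n (shadow α β p) ≤ 2 * gauss n (shadow α β p ∩ A))
    (hAB : A ⊆ B) (hA : MeasurableSet A)
    (hS : ∀ x ∈ A, areaFn α β q f x ≤ ENNReal.ofReal t) :
    eLpNorm (T.indicator f) q (halfMeasure n) ≤
      ENNReal.ofReal (2 * t) * gauss n B ^ (q⁻¹).toReal := by
  have hq1 := one_le_toReal hq h
  have hq0 := toReal_pos_of_one_le hq h
  have hint : ∫⁻ p, ‖T.indicator f p‖ₑ ^ q.toReal ∂(halfMeasure n) ≤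
      (2 * ENNReal.ofReal t) ^ q.toReal * gauss n B := by
    calc ∫⁻ p, ‖T.indicator f p‖ₑ ^ q.toReal ∂(halfMeasure n)
        ≤ ∫⁻ p, 2 * (‖f p‖ₑ ^ q.toReal / gauss n (shadow α β p) * gauss n (shadow α β p ∩ A))
            ∂(halfMeasure n) := by
          refine lintegral_mono fun p => ?_
          by_cases hp : p ∈ T
          · rw [Set.indicator_of_mem hp, mul_left_comm]
            refine le_trans ?_ (mul_le_mul_right (hTA p hp) _)
            rw [ENNReal.div_mul_cancel (gauss_shadow_ne_zero hα hβ p) (gauss_shadow_ne_top p)]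
          · simp [hp, hq0]
      _ = 2 * ∫⁻ x in A, areaFn α β q f x ^ q.toReal ∂(gauss n) := by
          rw [lintegral_const_mul' _ _ ENNReal.ofNat_ne_top]
          simp only [areaFn_eq_area]
          rw [setLIntegral_area_rpow hq h hf.enorm]
      _ ≤ 2 * ∫⁻ x in A, ENNReal.ofReal t ^ q.toReal ∂(gauss n) := by
          gcongr 2 * ?_
          refine setLIntegral_mono' hA fun x hx => ?_
          gcongr
          exact hS x hx
      -- The factor 2 is weakened to `2^q` so that the `q`-th root is exactly `2t`.
      _ ≤ 2 ^ q.toReal * (ENNReal.ofReal t ^ q.toReal * gauss n B) := by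
          rw [setLIntegral_const]
          gcongr
          simpa using ENNReal.rpow_le_rpow_of_exponent_le (x := 2) one_le_two hq1
      _ = _ := by rw [ENNReal.mul_rpow_of_nonneg _ _ hq0.le, mul_assoc]
  rw [eLpNorm_eq_lintegral_rpow_enorm_toReal (one_pos.trans_le hq).ne' h]
  refine (ENNReal.rpow_le_rpow hint (by positivity)).trans (le_of_eq ?_)
  rw [ENNReal.mul_rpow_of_nonneg _ _ (by positivity), ← ENNReal.rpow_mul,
    mul_one_div_cancel hq0.ne', ENNReal.rpow_one, ENNReal.toReal_inv, one_div,
    ENNReal.ofReal_mul two_pos.le, ENNReal.ofReal_ofNat]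

/-- Tonelli over the set `{S = 0}`, where the integral of `S^q` is zero. It ensures that the lowest
layers miss no part of `f`. -/
lemma ae_eq_zero_or_gauss_shadow_inter_eq_zero (hq : 1 ≤ q) (h : q ≠ ⊤)
    {f : HalfSpace n → ℝ} (hf : AEMeasurable f (halfMeasure n)) :
    ∀ᵐ p ∂(halfMeasure n), f p = 0 ∨
      gauss n (shadow α β p ∩ {x | areaFn α β q f x = 0}) = 0 := by
  have hq0 := toReal_pos_of_one_le hq h
  have hm : Measurable (areaFn α β q f) := measurable_area hf.enorm
  have hZ : MeasurableSet {x | areaFn α β q f x = 0} := hm (measurableSet_singleton 0)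
  have hmeas : Measurable fun p : HalfSpace n =>
      gauss n (shadow α β p ∩ {x | areaFn α β q f x = 0}) := by
    have h1 : Measurable fun p : HalfSpace n =>
        gauss n ((fun x => (x, p)) ⁻¹' ({z : E n × HalfSpace n | z.1 ∈ shadow α β z.2} ∩
          Prod.fst ⁻¹' {x | areaFn α β q f x = 0})) :=
      measurable_measure_prodMk_right
        ((isOpen_incidence α β).measurableSet.inter (measurable_fst hZ))
    exact h1
  have hint := setLIntegral_area_rpow (α := α) (β := β) hq h hf.enorm
    {x | areaFn α β q f x = 0}
  have hae : AEMeasurable (fun p => ‖f p‖ₑ ^ q.toReal / gauss n (shadow α β p) *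
      gauss n (shadow α β p ∩ {x | areaFn α β q f x = 0})) (halfMeasure n) :=
    ((hf.enorm.pow_const _).div measurable_gauss_shadow.aemeasurable).mul hmeas.aemeasurable
  rw [setLIntegral_congr_fun (g := fun _ => 0) hZ, lintegral_zero, eq_comm,
    lintegral_eq_zero_iff' hae] at hint
  · filter_upwards [hint] with p hp
    simpa [gauss_shadow_ne_top, hq0, hq0.not_gt] using hp
  · intro x hx
    have hx' : area α β q (fun p => ‖f p‖ₑ) x = 0 := hx
    simp [hx', hq0]

lemma exists_tentLayering (n : ℕ) (hα : 0 < α) (hβ : 0 < β) (hq : 1 ≤ q) (h : q ≠ ⊤) :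
    ∃ K : ℝ≥0∞, K ≠ ⊤ ∧ ∀ f : HalfSpace n → ℝ, MemTent α β q f →
      ∃ (O : ℤ → Set (E n)) (g : ℤ → HalfSpace n → ℝ), IsTentLayering α β q f O g ∧
        ∑' k : ℤ, ENNReal.ofReal ((2 : ℝ) ^ (k + 2)) * gauss n (O k) ≤ K * tentNorm α β q f := by
  obtain ⟨K, hK, hhull⟩ := exists_gauss_densityHull_le n hα hβ
  refine ⟨K * 8, ENNReal.mul_ne_top hK ENNReal.ofNat_ne_top, fun f hf => ?_⟩
  set S := areaFn α β q f with hS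
  have hSm : Measurable S := measurable_area hf.aemeasurable.enorm
  set L : ℤ → Set (E n) := fun k => {x | ENNReal.ofReal ((2 : ℝ) ^ k) < S x} with hL
  have hLm : ∀ k, MeasurableSet (L k) := fun k => hSm measurableSet_Ioi
  have hLanti : Antitone L := fun k l hkl x hx =>
    lt_of_le_of_lt (ENNReal.ofReal_le_ofReal (zpow_right_mono₀ one_le_two hkl)) hx
  set H : ℤ → Set (E n) := fun k => densityHull α β (L k) with hH
  set u : ℤ → HalfSpace n → ℝ := fun k => (tent α β (H k)).indicator f with hu
  have hTanti : ∀ {k l : ℤ}, k ≤ l → tent α β (H l) ⊆ tent α β (H k) := fun hkl =>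
    tent_mono (densityHull_mono (hLanti hkl))
  have hTm : ∀ O : Set (E n), MeasurableSet (tent α β O) := fun O =>
    (isClosed_tent α β O).measurableSet
  have hdiff : ∀ k, (fun p => u k p - u (k + 1) p) =
      (tent α β (H k) \ tent α β (H (k + 1))).indicator f := fun k =>
    (Set.indicator_sdiff (hTanti (by omega)) f).symm
  have htsum : ∑' k : ℤ, ENNReal.ofReal ((2 : ℝ) ^ (k + 2)) * gauss n (H k) ≤
      K * 8 * tentNorm α β q f := by
    calc ∑' k : ℤ, ENNReal.ofReal ((2 : ℝ) ^ (k + 2)) * gauss n (H k)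
        ≤ ∑' k : ℤ, K * (ENNReal.ofReal ((2 : ℝ) ^ (k + 2)) * gauss n (L k)) := by
          refine ENNReal.tsum_le_tsum fun k => ?_
          rw [mul_left_comm]
          gcongr
          exact hhull _ (hLm k)
      _ ≤ K * (8 * tentNorm α β q f) := by
          rw [ENNReal.tsum_mul_left]
          gcongr
          exact tsum_mul_measure_dyadic_le _ hSm
      _ = _ := (mul_assoc _ _ _).symm
  -- If `p` were in all the tents, its shadow would lie in every `H N`, making `2^{N+2} γ(shadow)`
  -- bounded in `N`.
  have hlarge : ∀ p, Tendsto (fun N : ℕ => u N p) atTop (𝓝 0) := fun p => by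
    have hpos : 0 < gauss n (shadow α β p) := gauss_ball_pos _ (coneRadius_pos hα hβ p)
    obtain ⟨N, hN⟩ : ∃ N : ℕ, p ∉ tent α β (H N) := by
      by_contra! hall
      have hbound : ∀ N : ℕ, N * gauss n (shadow α β p) ≤ K * 8 * tentNorm α β q f := fun N => by
        refine le_trans ?_ ((ENNReal.le_tsum (N : ℤ)).trans htsum)
        gcongr
        · rw [← ENNReal.ofReal_natCast]
          refine ENNReal.ofReal_le_ofReal ?_
          have h1 : (N : ℝ) ≤ 2 ^ N := by exact_mod_cast (Nat.lt_two_pow_self (n := N)).le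
          have h2 : (2 : ℝ) ^ (N : ℤ) ≤ 2 ^ ((N : ℤ) + 2) :=
            zpow_right_mono₀ one_le_two (by omega)
          rw [zpow_natCast] at h2
          exact h1.trans h2
        · exact mem_tent_iff.1 (hall N)
      obtain ⟨N, hN⟩ := ENNReal.exists_nat_mul_gt hpos.ne'
        (ENNReal.mul_ne_top (ENNReal.mul_ne_top hK (ENNReal.ofNat_ne_top (n := 8))) hf.norm_lt_top.ne)
      exact hN.not_ge (hbound N)
    refine tendsto_const_nhds.congr' ?_
    filter_upwards [eventually_ge_atTop N] with M hM
    exact (Set.indicator_of_notMem (fun h' => hN (hTanti (by exact_mod_cast hM) h')) f).symm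
  have hsmall : ∀ᵐ p ∂(halfMeasure n), Tendsto (fun N : ℕ => u (-N) p) atTop (𝓝 (f p)) := by
    filter_upwards [ae_eq_zero_or_gauss_shadow_inter_eq_zero (α := α) (β := β) hq h
      hf.aemeasurable] with p hp
    rcases hp with hp | hp
    · have : ∀ N : ℕ, u (-N) p = 0 := fun N => by simp [hu, hp]
      simp only [this, hp]
      exact tendsto_const_nhds
    -- The parts of the shadow outside `L (-N)` decrease to a null set, so eventually they fill less
    -- than half of it and `p` enters the tent over `H (-N)`.
    · have hInter : (⋂ N : ℕ, shadow α β p ∩ (L (-N))ᶜ) =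
          shadow α β p ∩ {x | areaFn α β q f x = 0} := by
        rw [← Set.inter_iInter]
        congr 1
        ext x
        simp only [hL, Set.mem_iInter, Set.mem_compl_iff, Set.mem_ofPred_eq, not_lt]
        refine ⟨fun hx => ?_, fun hx N => by rw [hS, hx]; exact zero_le⟩
        have hlim : Tendsto (fun N : ℕ => ENNReal.ofReal ((2 : ℝ) ^ (-N : ℤ))) atTop (𝓝 0) := by
          rw [← ENNReal.ofReal_zero]
          refine (ENNReal.continuous_ofReal.tendsto 0).comp ?_
          refine (tendsto_pow_atTop_nhds_zero_of_lt_one (r := (1 / 2 : ℝ)) (by norm_num)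
            (by norm_num)).congr fun N => ?_
          simp
        exact le_antisymm (ge_of_tendsto' hlim hx) zero_le
      have hlim : Tendsto (fun N : ℕ => gauss n (shadow α β p ∩ (L (-N))ᶜ)) atTop (𝓝 0) := by
        rw [← hp, ← hInter]
        refine tendsto_measure_iInter_atTop
          (fun N => (measurableSet_ball.inter (hLm _).compl).nullMeasurableSet) ?_
          ⟨0, measure_ne_top_of_subset Set.inter_subset_left (gauss_shadow_ne_top p)⟩
        intro N M hNM
        exact Set.inter_subset_inter_right _ (Set.compl_subset_compl.2 (hLanti (by simpa using hNM)))
      have hlim2 := ENNReal.Tendsto.const_mul (a := 2) hlim (Or.inr ENNReal.ofNat_ne_top)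
      rw [mul_zero] at hlim2
      have hpos : 0 < gauss n (shadow α β p) := gauss_ball_pos _ (coneRadius_pos hα hβ p)
      refine tendsto_const_nhds.congr' ?_
      filter_upwards [hlim2.eventually_lt_const hpos] with N hN
      have hmem : p ∈ tent α β (H (-N)) := by
        by_contra hn
        exact hN.not_ge (gauss_shadow_le_of_notMem_tent (hLm _) hn)
      exact (Set.indicator_of_mem hmem f).symm
  refine ⟨H, fun k p => u k p - u (k + 1) p, ⟨fun k => isOpen_densityHull _, fun k => ?_,
    fun k htop => absurd htop h, fun k p hp => ?_, fun k c r => ?_, ?_, fun htop => absurd htop h⟩,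
    htsum⟩
  · exact (hf.aemeasurable.indicator (hTm _)).sub (hf.aemeasurable.indicator (hTm _))
  · have : p ∉ tent α β (H (k + 1)) := fun h' => hp (hTanti (by omega) h')
    simp [hu, hp, this]
  · rw [hdiff, Set.indicator_indicator, show (2 : ℝ) ^ (k + 2) = 2 * 2 ^ (k + 1) by
      rw [← zpow_one_add₀ two_ne_zero]; congr 1; ring]
    -- Here `A` is the part of the ball where `S ≤ 2^{k+1}`; points of the tent over the ball have
    -- shadows inside it, so intersecting with the ball loses nothing.
    refine eLpNorm_indicator_le_of_shadow hα hβ hq h hf.aemeasurable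
      (A := Metric.ball c r ∩ (L (k + 1))ᶜ) ?_
      Set.inter_subset_left (measurableSet_ball.inter (hLm _).compl)
      (fun x hx => not_lt.1 hx.2)
    intro p hp
    rw [← Set.inter_assoc, Set.inter_eq_left.2 (mem_tent_iff.1 hp.1)]
    exact gauss_shadow_le_of_notMem_tent (hLm _) hp.2.2
  · filter_upwards [hsmall] with p hp
    have hsum : ∀ N : ℕ, ∑ k ∈ Finset.Ico (-(N : ℤ)) N, (u k p - u (k + 1) p) =
        u (-N) p - u N p := fun N => by
      have := sum_Ico_int_sub (fun k => -u k p) N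
      simp only [neg_sub_neg] at this
      exact this
    simp only [hsum]
    simpa using hp.sub (hlarge p)

/-! ### The atomic decomposition -/

lemma exists_atomic_decomposition (n : ℕ) (hα : 0 < α) (hβ : 0 < β) (hq : 1 ≤ q) :
    ∃ δ : ℝ, 0 < δ ∧ ∃ C : ℝ, 0 < C ∧ ∀ f : HalfSpace n → ℝ, MemTent α β q f →
      ∃ (lam : ℕ → ℝ) (a : ℕ → HalfSpace n → ℝ), (∀ m, IsAtom α β δ q (a m)) ∧
        Summable (fun m => |lam m|) ∧ IsSumOf α β q lam a f ∧
        ∑' m, |lam m| ≤ C * (tentNorm α β q f).toReal := by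
  obtain ⟨δ, hδ, K, hK, hatoms⟩ := exists_atoms_of_tents n hα hβ
  obtain ⟨K', hK', hlayer⟩ : ∃ K : ℝ≥0∞, K ≠ ⊤ ∧ ∀ f : HalfSpace n → ℝ, MemTent α β q f →
      ∃ (O : ℤ → Set (E n)) (g : ℤ → HalfSpace n → ℝ), IsTentLayering α β q f O g ∧
        ∑' k : ℤ, ENNReal.ofReal ((2 : ℝ) ^ (k + 2)) * gauss n (O k) ≤ K * tentNorm α β q f := by
    by_cases h : q = ⊤
    · subst h
      exact ⟨8, ENNReal.ofNat_ne_top, exists_tentLayering_top⟩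
    · exact exists_tentLayering n hα hβ hq h
  have hKK : K * K' ≠ ⊤ := ENNReal.mul_ne_top hK hK'
  -- The added 1 only makes the constant positive.
  refine ⟨δ, hδ, (K * K').toReal + 1, by positivity, fun f hf => ?_⟩
  obtain ⟨O, g, hg, hsum⟩ := hlayer f hf
  obtain ⟨lam, a, ha, hlam, hconv⟩ := hatoms q O g (fun k => 2 ^ (k + 2)) hg.isOpen
    (fun k => by positivity) hg.aemeasurable hg.continuous_of_top hg.eq_zero hg.eLpNorm_le
  have hbound : ∑' m, ‖lam m‖ₑ ≤ K * K' * tentNorm α β q f :=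
    hlam.trans (by rw [mul_assoc]; gcongr)
  have hfin : K * K' * tentNorm α β q f ≠ ⊤ := ENNReal.mul_ne_top hKK hf.norm_lt_top.ne
  have hsumm : Summable fun m => |lam m| :=
    tsum_enorm_ne_top_iff_summable_norm.1 (hbound.trans_lt hfin.lt_top).ne
  have hm := fun m => (ha m).aemeasurable
  have hnorm := fun m => (ha m).tentNorm_le_one hα hβ hq
  obtain ⟨f', -, hf', -⟩ := exists_memTent_isSumOf hα hβ hq hsumm hm
    (fun h m => (ha m).continuous_of_top h) hnorm
  -- The sum `f' p` of the atomic series is also the unconditional sum of the layers, hence the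
  -- limit over the symmetric ranges `[-N, N)`, which is `f p`.
  have huniq : ∀ p, HasSum (fun m => lam m * a m p) (f' p) →
      Tendsto (fun N : ℕ => ∑ k ∈ Finset.Ico (-(N : ℤ)) N, g k p) atTop (𝓝 (f p)) →
      HasSum (fun m => lam m * a m p) (f p) := fun p h1 h2 => by
    have h3 := Tendsto.comp (hconv p _ h1) (Finset.tendsto_Ico_neg (R := ℤ))
    rwa [tendsto_nhds_unique h2 h3]
  refine ⟨lam, a, ha, hsumm, isSumOf_of_hasSum hq hsumm hm hnorm ?_
    fun h p => huniq p (hf'.hasSum_of_top h p) (hg.tendsto_of_top h p), ?_⟩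
  · filter_upwards [hf'.hasSum_ae, hg.tendsto_ae] with p h1 h2 using huniq p h1 h2
  · rw [tsum_enorm_eq_ofReal hsumm, ENNReal.ofReal_le_iff_le_toReal hfin, ENNReal.toReal_mul]
      at hbound
    refine hbound.trans ?_
    gcongr
    linarith

end GaussTent

theorem theorem3p1 (n : ℕ) (hn : 1 ≤ n) (α β : ℝ) (hα : 0 < α) (hβ : 0 < β)
    (q : ℝ≥0∞) (hq : 1 ≤ q) :
    -- the atomic decomposition
    (∃ δ : ℝ, 0 < δ ∧ ∃ C : ℝ, 0 < C ∧
      ∀ f : GaussTent.HalfSpace n → ℝ, GaussTent.MemTent α β q f →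
        ∃ (lam : ℕ → ℝ) (a : ℕ → GaussTent.HalfSpace n → ℝ),
          (∀ m, GaussTent.IsAtom α β δ q (a m)) ∧
          Summable (fun m => |lam m|) ∧
          GaussTent.IsSumOf α β q lam a f ∧
          ∑' m, |lam m| ≤ C * (GaussTent.tentNorm α β q f).toReal) ∧
    -- atoms lie in the closed unit ball
    (∀ δ : ℝ, 0 < δ → ∀ a : GaussTent.HalfSpace n → ℝ, GaussTent.IsAtom α β δ q a →
      GaussTent.MemTent α β q a ∧ GaussTent.tentNorm α β q a ≤ 1) ∧
    -- conversely, absolutely summable combinations of atoms belong to the space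
    (∀ δ : ℝ, 0 < δ → ∀ (lam : ℕ → ℝ) (a : ℕ → GaussTent.HalfSpace n → ℝ),
      (∀ m, GaussTent.IsAtom α β δ q (a m)) → Summable (fun m => |lam m|) →
        ∃ f : GaussTent.HalfSpace n → ℝ, GaussTent.MemTent α β q f ∧
          GaussTent.IsSumOf α β q lam a f ∧
          (GaussTent.tentNorm α β q f).toReal ≤ ∑' m, |lam m|) :=
  ⟨GaussTent.exists_atomic_decomposition n hα hβ hq,
    fun _ _ _ ha => ⟨ha.memTent hα hβ hq, ha.tentNorm_le_one hα hβ hq⟩,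
    fun _ _ _ _ ha hlam => GaussTent.exists_memTent_isSumOf hα hβ hq hlam
      (fun m => (ha m).aemeasurable) (fun h m => (ha m).continuous_of_top h)
      fun m => (ha m).tentNorm_le_one hα hβ hq⟩
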